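/- Let $\mathbb X$ be a compact connected smooth Riemannian manifold without boundary, with geodesic distance $\rho$ and closed balls $B(x,r)=\{y:\rho(x,y)\le r\}$, and let $\mu$ be a Borel probability measure on $\mathbb X$. Let $\alpha,\kappa_1,\kappa_2,\kappa_3,\kappa_4>0$ and assume $\mu(B(x,r))\le\kappa_1r^\alpha$ for all $x\in\mathbb X$, $r>0$. Then there are constants $c_1,c_2,c_3>0$, depending only on $\mathbb X,\rho,\mu,\alpha,\kappa_1,\dots,\kappa_4$, with the following property. Let $\{\phi_k\}_{k\ge0}$ be a system of continuous complex-valued functions on $\mathbb X$, orthonormal in $L^2(\mu)$, with $\phi_0\equiv1$, and let $\{\ell_k\}_{k\ge0}$ be a nondecreasing real sequence with $\ell_0=1$, $\ell_k\to\infty$. Suppose that the heat kernel $K_t(x,y)=\sum_{k\ge0}e^{-\ell_k^2t}\phi_k(x)\overline{\phi_k(y)}$ is differentiable in $y$ and satisfies, for all $x,y\in\mathbb X$ and $0<t\le1$, $$|K_t(x,y)|\le\kappa_2t^{-\alpha/2}e^{-\kappa_3\rho(x,y)^2/t},\quad |d_yK_t(x,y)(v)|\le\kappa_2t^{-\alpha/2-1/2}e^{-\kappa_3\rho(x,y)^2/t}\,\|v\|_y\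 \ (v\in T_y\mathbb X),\quad K_t(x,x)\ge\kappa_4t^{-\alpha/2}.$$ For real $L$ let $\Pi_L=\mathrm{span}_{\mathbb C}\{\phi_j:\ell_j\le L\}$. For $S\subseteq\mathbb X$ let $\delta(S)=\sup_{x\in\mathbb X}\rho(x,S)$ (with $\delta(\emptyset)=\infty$), and for finite $\mathcal C\subset\mathbb X$ let $q(\mathcal C)=\min_{x\ne y\in\mathcal C}\rho(x,y)$ (with $q(\mathcal C)=\infty$ if $\mathcal C$ has at most one point). Let $\nu$ be a finite signed Borel measure on $\mathbb X$ with total variation measure $|\nu|$ and $\mathrm{supp}(\nu)=\{x:|\nu|(B(x,r))>0\ \forall r>0\}$, and let $\delta(\mathrm{supp}(\nu))<d\le1/81$. (a) Let $\mathcal C=\{x_1,\dots,x_M\}\subseteq\mathrm{supp}(\nu)$ be finite with $\tfrac12q(\mathcal C)\le\delta(\mathcal C)\le81d\le162\,q(\mathcal C)$, and let $\{Y_k\}_{k=1}^M$ be a partition of $\mathbb X$ into Borel sets such that, for some constants $b_1,b_2,b_3>0$ (on which $c_1,c_2,c_3$ do not depend) and some finite set $\tilde{\mathcal C}\supseteq\mathcal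 C$, for every $k$, $$x_k\in Y_k\subseteq B(x_k,81d),\qquad b_1d^\alpha\le\mu(Y_k)\le b_2d^\alpha,\qquad |\nu|(Y_k)\ge b_3\min_{z\in\tilde{\mathcal C}}|\nu|(B(z,d/4))>0 .$$ If $1\le p<\infty$, $0<\eta\le1$, $d\le c_1$ and $L\le c_2\eta/(pd)$, then for every $P\in\Pi_L$ $$\sum_{k=1}^M\left|\int_{Y_k}|P|^p\,d\mu-\frac{\mu(Y_k)}{|\nu|(Y_k)}\int_{Y_k}|P|^p\,d|\nu|\right|\le\eta\,\|P\|_{\mu;p}^p .$$ (b) If $\eta>0$ and $L\le c_3\eta/d$, then for every $P\in\Pi_L$ $$\bigl|\,\|P\|_{\nu;\infty}-\|P\|_{\mu;\infty}\bigr|\le\eta\,\|P\|_{\mu;\infty}.$$ Here $\|P\|_{\mu;p}=(\int|P|^p\,d\mu)^{1/p}$, and $\|P\|_{\nu;\infty}$, $\|P\|_{\mu;\infty}$ are the essential suprema of $|P|$ with respect to $|\nu|$ and $\mu$. -/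

import Mathlib

open MeasureTheory Manifold ContDiff
open scoped ENNReal ComplexConjugate Bundle

noncomputable section

/-- The heat kernel `K_t(x, y) = ∑ₖ exp(-ℓₖ² t) φₖ(x) conj(φₖ(y))`. -/
def heatKernel {M : Type*} [TopologicalSpace M] (φ : ℕ → C(M, ℂ)) (ℓ : ℕ → ℝ)
    (t : ℝ) (x y : M) : ℂ :=
  ∑' k : ℕ, (Real.exp (-(ℓ k) ^ 2 * t) : ℂ) * φ k x * conj (φ k y)

/-- The space `Π_L` of diffusion polynomials of degree at most `L`: the complex span of
the `φⱼ` with `ℓⱼ ≤ L`. -/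
def diffusionPoly {M : Type*} [TopologicalSpace M] (φ : ℕ → C(M, ℂ)) (ℓ : ℕ → ℝ) (L : ℝ) :
    Submodule ℂ C(M, ℂ) :=
  Submodule.span ℂ (φ '' {j | ℓ j ≤ L})

/-- The derivative `df_y(v)` of a complex valued function on a manifold in the tangent
direction `v`. -/
def tangentDeriv {q : ℕ} {M : Type*} [TopologicalSpace M]
    [ChartedSpace (EuclideanSpace ℝ (Fin q)) M] (f : M → ℂ) (y : M)
    (v : TangentSpace (𝓡 q) y) : ℂ :=
  mfderiv (𝓡 q) 𝓘(ℝ, ℂ) f y v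

/-- The standing assumptions on the orthonormal system `φ` and the sequence `ℓ`. -/
structure IsDiffusionSystem {q : ℕ} {M : Type*} [MetricSpace M]
    [ChartedSpace (EuclideanSpace ℝ (Fin q)) M]
    [Bundle.RiemannianBundle (fun x : M => TangentSpace (𝓡 q) x)]
    [MeasurableSpace M] (μ : Measure M) (α κ₂ κ₃ κ₄ : ℝ)
    (φ : ℕ → C(M, ℂ)) (ℓ : ℕ → ℝ) : Prop where
  orthonormal : ∀ j k : ℕ, ∫ x, φ j x * conj (φ k x) ∂μ = if j = k then 1 else 0
  phi_zero : ∀ x, φ 0 x = 1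
  ell_zero : ℓ 0 = 1
  ell_mono : Monotone ℓ
  ell_tendsto : Filter.Tendsto ℓ Filter.atTop Filter.atTop
  /-- Gaussian upper bound. -/
  gaussian_upper : ∀ t : ℝ, 0 < t → t ≤ 1 → ∀ x y : M,
    ‖heatKernel φ ℓ t x y‖ ≤ κ₂ * t ^ (-(α / 2)) * Real.exp (-κ₃ * dist x y ^ 2 / t)
  /-- The kernel is differentiable in its second variable. -/
  differentiable : ∀ t : ℝ, 0 < t → t ≤ 1 → ∀ x : M,
    MDifferentiable (𝓡 q) 𝓘(ℝ, ℂ) (heatKernel φ ℓ t x)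
  /-- Gaussian bound for the length of the gradient in the second variable, that is, for the
  norm of the differential with respect to the Riemannian metric at `y`. -/
  gaussian_gradient : ∀ t : ℝ, 0 < t → t ≤ 1 → ∀ (x y : M) (v : TangentSpace (𝓡 q) y),
    ‖tangentDeriv (heatKernel φ ℓ t x) y v‖ ≤
      κ₂ * t ^ (-(α / 2) - 1 / 2) * Real.exp (-κ₃ * dist x y ^ 2 / t) * ‖v‖
  /-- Lower bound on the diagonal. As it is positive, it also says that the series for
  `K_t(x, x)`, and hence by the Cauchy-Schwarz inequality the series for every `K_t(x, y)`,
  converges: the sum of a divergent series is read as `0`. -/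
  diagonal_lower : ∀ t : ℝ, 0 < t → t ≤ 1 → ∀ x : M,
    κ₄ * t ^ (-(α / 2)) ≤ (heatKernel φ ℓ t x x).re

/-- The mesh norm `δ(S) = sup_x ρ(x, S)` with respect to the whole space (infinite if `S` is
empty). -/
def meshNorm {M : Type*} [MetricSpace M] (S : Set M) : ℝ≥0∞ :=
  ⨆ x : M, Metric.infEDist x S

/-- A finite set `C ⊆ supp ν` of centres and a partition `(Y x)_{x ∈ C}` of the space that are
adapted to `μ`, `ν` and the scale `d`. The minimal separation `q(C)` is `Set.einfsep C`; the
numbers `b₁, b₂` are the constants in `μ(Y x) ∼ d ^ α`, and `b₃` is the constant in the lower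
bound for `|ν|(Y x)`. -/
structure IsAdaptedPartition {M : Type*} [MetricSpace M] [MeasurableSpace M]
    (μ : Measure M) (ν : SignedMeasure M) (α d b₁ b₂ b₃ : ℝ)
    (C : Finset M) (Y : M → Set M) : Prop where
  subset_support : (C : Set M) ⊆ ν.totalVariation.support
  sep_le_mesh : Set.einfsep (C : Set M) / 2 ≤ meshNorm (C : Set M)
  mesh_le : meshNorm (C : Set M) ≤ ENNReal.ofReal (81 * d)
  le_sep : ENNReal.ofReal (81 * d) ≤ 162 * Set.einfsep (C : Set M)
  measurable : ∀ x ∈ C, MeasurableSet (Y x)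
  disjoint : (C : Set M).PairwiseDisjoint Y
  cover : ⋃ x ∈ C, Y x = Set.univ
  mem : ∀ x ∈ C, x ∈ Y x
  subset_ball : ∀ x ∈ C, Y x ⊆ Metric.closedBall x (81 * d)
  mu_lower : ∀ x ∈ C, b₁ * d ^ α ≤ μ.real (Y x)
  mu_upper : ∀ x ∈ C, μ.real (Y x) ≤ b₂ * d ^ α
  /-- `|ν|(Y x) ≥ b₃ min_{z ∈ D} |ν|(B(z, d/4)) > 0` for a finite set `D ⊇ C`. -/
  nu_lower : ∃ D : Finset M, C ⊆ D ∧
    (∀ z ∈ D, 0 < ν.totalVariation (Metric.closedBall z (d / 4))) ∧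
    ∀ x ∈ C, ∃ z ∈ D,
      b₃ * ν.totalVariation.real (Metric.closedBall z (d / 4)) ≤ ν.totalVariation.real (Y x)

end

/-! Both parts rest on one oscillation estimate, `exists_oscillation_bound`: for `P ∈ Π_L` with `L ≥
1` and `L r ≤ 1`, one has `|P x - P z| ≤ f x` whenever `ρ(x, z) ≤ r`, where `‖f‖_p ≤ A L r ‖P‖_p`
for all finite `p ≥ 1`, also `f ≤ A L r ‖P‖_∞`, and `A` depends neither on `p` and `L` nor on the
system. For (a), `|P|^p` is compared on each cell with its `|ν|`-average; the error is a
`μ`-integral of the oscillation, whatever the positive size of `|ν|` on the cell. For (b), every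
point is within `d` of the support of `ν`, and `μ` has full support, so its essential supremum is
the maximum.

For the estimate, let `T` be the heat operator at time `L⁻²`. Its eigenvalues on `Π_L` lie in `[1/e,
1]`, so `P = T Q` with `Q ∈ Π_L`. The gradient bound shows that moving a point by `r` changes the
kernel of `T` by `L r` times a rapidly decaying kernel, so Schur's test controls the oscillation of
`P` by `L r ‖Q‖_p`.

It remains to bound `Q = T⁻¹ P` by `P` in every `Lᵖ`. A trigonometric series `∑ cₙ exp (2πinu)` with
rapidly decreasing coefficients equals `u⁻³` on `[1/e, 1]`, hence `Q = ∑ cₙ T exp (2πinT) T P`. The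
outer factors `T` turn each term into an integral operator with a continuous kernel. The `L¹` norms
of its rows grow only polynomially in `n`: a commutator of `T` with the weight `(1 + L ρ(x, ·))^m`
costs one power of the weight, while `exp (2πinT)` is isometric in `L²`, so induction on `m` gives
weighted `L²` bounds (`norm_weight_exp_pow_le`), and Cauchy-Schwarz passes to `L¹`. Summing against
`|cₙ|` gives a kernel to which Schur's test applies, with constants free of `L`. -/

/-! ### Mean value and tangent line inequalities. -/

/-- Mean value inequality on a Riemannian manifold, along a nearly minimizing path. -/
lemma norm_sub_le_of_tangentDeriv_le {q : ℕ} {M : Type*} [MetricSpace M]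
    [ChartedSpace (EuclideanSpace ℝ (Fin q)) M]
    [Bundle.RiemannianBundle (fun x : M => TangentSpace (𝓡 q) x)]
    [IsRiemannianManifold (𝓡 q) M] {f : M → ℂ} (hf : MDifferentiable (𝓡 q) 𝓘(ℝ, ℂ) f)
    {y z : M} {r C : ℝ} (hr : dist y z < r) (hC : 0 ≤ C)
    (h : ∀ u, dist y u < r → ∀ v : TangentSpace (𝓡 q) u, ‖tangentDeriv f u v‖ ≤ C * ‖v‖) :
    ‖f z - f y‖ ≤ C * r := by
  have hr0 : 0 < r := dist_nonneg.trans_lt hr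
  have hr' : riemannianEDist (𝓡 q) y z < ENNReal.ofReal r := by
    rw [← IsRiemannianManifold.out (I := 𝓡 q), edist_dist]
    exact (ENNReal.ofReal_lt_ofReal_iff hr0).2 hr
  obtain ⟨γ, h0, h1, hγ, hlen⟩ := exists_lt_of_riemannianEDist_lt hr'
  -- An initial segment is no longer than the whole path, so the path stays in the ball where the
  -- derivative bound is available.
  have hmem : ∀ t ∈ Set.Icc (0 : ℝ) 1, dist y (γ t) < r := by
    intro t ht
    have h2 : riemannianEDist (𝓡 q) y (γ t) ≤ pathELength (𝓡 q) γ 0 t :=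
      riemannianEDist_le_pathELength (hγ.mono (Set.Icc_subset_Icc_right ht.2)) h0 rfl ht.1
    have h3 := (h2.trans (pathELength_mono le_rfl ht.2)).trans_lt hlen
    rw [← IsRiemannianManifold.out (I := 𝓡 q), edist_dist] at h3
    exact (ENNReal.ofReal_lt_ofReal_iff hr0).1 h3
  have hγd : ∀ t ∈ Set.Ioo (0 : ℝ) 1, MDifferentiableAt 𝓘(ℝ, ℝ) (𝓡 q) γ t := fun t ht =>
    (hγ.mdifferentiableOn one_ne_zero).mdifferentiableAt (Icc_mem_nhds ht.1 ht.2)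
  have hd : ∀ t ∈ Set.Ioo (0 : ℝ) 1, DifferentiableAt ℝ (f ∘ γ) t := fun t ht =>
    mdifferentiableAt_iff_differentiableAt.1 ((hf _).comp t (hγd t ht))
  have hbd : ∀ t ∈ Set.Ioo (0 : ℝ) 1, ‖deriv (f ∘ γ) t‖ₑ ≤
      ENNReal.ofReal C * ‖mfderiv 𝓘(ℝ, ℝ) (𝓡 q) γ t 1‖ₑ := by
    intro t ht
    have e1 : deriv (f ∘ γ) t = tangentDeriv f (γ t) (mfderiv 𝓘(ℝ, ℝ) (𝓡 q) γ t 1) := by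
      rw [← fderiv_apply_one_eq_deriv, ← mfderiv_eq_fderiv, mfderiv_comp t (hf _) (hγd t ht)]
      rfl
    rw [e1, ← ofReal_norm, ← ofReal_norm, ← ENNReal.ofReal_mul hC]
    exact ENNReal.ofReal_le_ofReal (h _ (hmem t (Set.Ioo_subset_Icc_self ht)) _)
  have hlin : ∫⁻ t in Set.Ioo (0 : ℝ) 1, ‖deriv (f ∘ γ) t‖ₑ ≤ ENNReal.ofReal (C * r) := by
    refine (setLIntegral_mono' measurableSet_Ioo hbd).trans ?_
    rw [lintegral_const_mul' _ _ ENNReal.ofReal_ne_top,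
      ← pathELength_eq_lintegral_mfderiv_Ioo, ENNReal.ofReal_mul hC]
    gcongr
  have hint : IntegrableOn (fun t => ‖deriv (f ∘ γ) t‖) (Set.Ioo (0 : ℝ) 1) := by
    refine ⟨(measurable_deriv _).norm.aestronglyMeasurable, ?_⟩
    simp only [HasFiniteIntegral, enorm_norm]
    exact hlin.trans_lt ENNReal.ofReal_lt_top
  have key := norm_sub_le_integral_of_norm_deriv_le_of_le (f := f ∘ γ)
    (B := fun t => ‖deriv (f ∘ γ) t‖) zero_le_one
    (hf.continuous.comp_continuousOn hγ.continuousOn)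
    (fun t ht => (hd t ht).differentiableWithinAt) (.of_forall fun _ _ => le_rfl)
    ((intervalIntegrable_iff_integrableOn_Ioo_of_le zero_le_one).2 hint)
  simp only [Function.comp_apply, h0, h1] at key
  refine key.trans ?_
  rw [intervalIntegral.integral_of_le zero_le_one, integral_Ioc_eq_integral_Ioo,
    integral_norm_eq_lintegral_enorm (measurable_deriv _).aestronglyMeasurable]
  exact ENNReal.toReal_le_of_le_ofReal (by positivity) hlin

lemma Continuous.integrable_of_compactSpace {X E : Type*} [TopologicalSpace X] [CompactSpace X]
    [MeasurableSpace X] [OpensMeasurableSpace X] [NormedAddCommGroup E]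
    [SecondCountableTopologyEither X E] {f : X → E} (hf : Continuous f) (μ : Measure X)
    [IsFiniteMeasure μ] : Integrable f μ := by
  obtain ⟨C, hC⟩ := (isCompact_range hf).isBounded.exists_norm_le
  exact Integrable.of_bound hf.aestronglyMeasurable C (.of_forall fun x => hC _ ⟨x, rfl⟩)

/-- Tangent line inequality for `x ↦ x ^ p`. -/
lemma mul_rpow_sub_one_mul_le {p s g : ℝ} (hp : 1 ≤ p) (hs : 0 ≤ s) (hg : 0 ≤ g) :
    p * s ^ (p - 1) * g ≤ (p - 1) * s ^ p + g ^ p := by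
  have hp0 : 0 < p := by linarith
  have h := Real.geom_mean_le_arith_mean2_weighted (w₁ := (p - 1) / p) (w₂ := 1 / p)
    (p₁ := s ^ p) (p₂ := g ^ p) (div_nonneg (by linarith) hp0.le) (by positivity)
    (by positivity) (by positivity) (by field_simp; ring)
  rw [← Real.rpow_mul hs, ← Real.rpow_mul hg, mul_div_cancel₀ _ hp0.ne',
    mul_div_cancel₀ _ hp0.ne', Real.rpow_one] at h
  calc p * s ^ (p - 1) * g = p * (s ^ (p - 1) * g) := by ring
    _ ≤ p * ((p - 1) / p * s ^ p + 1 / p * g ^ p) := by gcongr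
    _ = _ := by field_simp

/-! ### Schur's test in `Lᵖ`. -/

section Schur

variable {X : Type*} [MetricSpace X] [CompactSpace X] [MeasurableSpace X] [BorelSpace X]
  {μ : Measure X} [IsFiniteMeasure μ]

lemma continuous_integral_mul {D : X → X → ℝ} (hD : Continuous fun z : X × X => D z.1 z.2)
    {g : X → ℝ} (hg : Continuous g) : Continuous fun x => ∫ y, D x y * g y ∂μ := by
  have h := continuous_parametric_integral_of_continuous (μ := μ) (f := fun x y => D x y * g y)
    (by exact hD.mul (hg.comp continuous_snd)) (isCompact_univ (X := X))
  simpa using h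

/-- Jensen's inequality for the measure `D μ` of mass at most `A`: integrate the tangent line
inequality at `s = f / A`. Normalizing by the bound `A` instead of the true mass avoids dividing by
a possibly vanishing integral. -/
lemma rpow_integral_mul_le {D g : X → ℝ} (hD : Continuous D) (hD0 : ∀ y, 0 ≤ D y)
    (hg : Continuous g) (hg0 : ∀ y, 0 ≤ g y) {A p : ℝ} (hA : 0 < A) (hp : 1 ≤ p)
    (hDA : ∫ y, D y ∂μ ≤ A) :
    (∫ y, D y * g y ∂μ) ^ p ≤ A ^ (p - 1) * ∫ y, D y * g y ^ p ∂μ := by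
  set f := ∫ y, D y * g y ∂μ with hf
  have hf0 : 0 ≤ f := integral_nonneg fun y => mul_nonneg (hD0 y) (hg0 y)
  have hgp : Continuous fun y => g y ^ p := hg.rpow_const fun _ => Or.inr (by linarith)
  have c1 : Continuous fun y => D y * g y := hD.mul hg
  have c2 : Continuous fun y => D y * g y ^ p := hD.mul hgp
  set s := f / A with hs
  have c3 : Continuous fun y => (p - 1) * s ^ p * D y := continuous_const.mul hD
  have hs0 : 0 ≤ s := by positivity
  have h1 : p * s ^ (p - 1) * f ≤ (p - 1) * s ^ p * A + ∫ y, D y * g y ^ p ∂μ := by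
    calc p * s ^ (p - 1) * f = ∫ y, p * s ^ (p - 1) * (D y * g y) ∂μ := by
          rw [hf, integral_const_mul]
      _ ≤ ∫ y, ((p - 1) * s ^ p * D y + D y * g y ^ p) ∂μ := by
          apply integral_mono ((c1.integrable_of_compactSpace μ).const_mul _)
            ((c3.integrable_of_compactSpace μ).add (c2.integrable_of_compactSpace μ))
          intro y
          have := mul_le_mul_of_nonneg_left (mul_rpow_sub_one_mul_le hp hs0 (hg0 y)) (hD0 y)
          simp only [Pi.add_apply]
          linarith
      _ = (p - 1) * s ^ p * ∫ y, D y ∂μ + ∫ y, D y * g y ^ p ∂μ := by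
          rw [integral_add (c3.integrable_of_compactSpace μ) (c2.integrable_of_compactSpace μ),
            integral_const_mul]
      _ ≤ _ := by
          have : 0 ≤ (p - 1) * s ^ p := mul_nonneg (by linarith) (by positivity)
          gcongr
  have hfs : f = s * A := by rw [hs]; field_simp
  have hsp : s ^ (p - 1) * s = s ^ p := by
    rcases hs0.eq_or_lt with h | h
    · rw [← h, Real.zero_rpow (by linarith : p ≠ 0), mul_zero]
    · rw [← Real.rpow_add_one h.ne', sub_add_cancel]
  have h2 : s ^ p * A ≤ ∫ y, D y * g y ^ p ∂μ := by
    have : p * s ^ (p - 1) * f = p * (s ^ p * A) := by rw [hfs, ← hsp]; ring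
    nlinarith
  calc f ^ p = s ^ p * A ^ p := by rw [hfs, Real.mul_rpow hs0 hA.le]
    _ = A ^ (p - 1) * (s ^ p * A) := by
        rw [Real.rpow_sub_one hA.ne']; field_simp
    _ ≤ _ := by gcongr

/-- Schur's test. -/
lemma integral_rpow_integral_mul_le {D : X → X → ℝ}
    (hD : Continuous fun z : X × X => D z.1 z.2) (hD0 : ∀ x y, 0 ≤ D x y)
    {g : X → ℝ} (hg : Continuous g) (hg0 : ∀ y, 0 ≤ g y) {A p : ℝ} (hA : 0 < A) (hp : 1 ≤ p)
    (hrow : ∀ x, ∫ y, D x y ∂μ ≤ A) (hcol : ∀ y, ∫ x, D x y ∂μ ≤ A) :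
    ∫ x, (∫ y, D x y * g y ∂μ) ^ p ∂μ ≤ A ^ p * ∫ y, g y ^ p ∂μ := by
  have hgp : Continuous fun y => g y ^ p := hg.rpow_const fun _ => Or.inr (by linarith)
  have hgp0 : ∀ y, 0 ≤ g y ^ p := fun y => Real.rpow_nonneg (hg0 y) _
  calc ∫ x, (∫ y, D x y * g y ∂μ) ^ p ∂μ
      ≤ ∫ x, A ^ (p - 1) * ∫ y, D x y * g y ^ p ∂μ ∂μ := by
        apply integral_mono
          (((continuous_integral_mul hD hg).rpow_const fun _ =>
            Or.inr (by linarith)).integrable_of_compactSpace μ)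
          ((continuous_const.mul (continuous_integral_mul hD hgp)).integrable_of_compactSpace μ)
        intro x
        exact rpow_integral_mul_le (hD.comp (Continuous.prodMk_right x)) (hD0 x) hg hg0 hA hp
          (hrow x)
    _ = A ^ (p - 1) * ∫ y, (∫ x, D x y ∂μ) * g y ^ p ∂μ := by
        rw [integral_const_mul, integral_integral_swap]
        · simp_rw [integral_mul_const]
        · exact (hD.mul (hgp.comp continuous_snd)).integrable_of_compactSpace _
    _ ≤ A ^ (p - 1) * ∫ y, A * g y ^ p ∂μ := by
        have hc : Continuous fun y => ∫ x, D x y ∂μ := by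
          simpa using continuous_integral_mul (μ := μ) (D := fun y x => D x y)
            (hD.comp continuous_swap) (continuous_const (y := (1 : ℝ)))
        gcongr ?_ * ?_
        refine integral_mono ((hc.mul hgp).integrable_of_compactSpace μ)
          ((hgp.integrable_of_compactSpace μ).const_mul _) fun y => ?_
        exact mul_le_mul_of_nonneg_right (hcol y) (hgp0 y)
    _ = _ := by
        rw [integral_const_mul, ← mul_assoc, ← Real.rpow_add_one hA.ne', sub_add_cancel]

end Schur

/-- Split the space into shells `m ≤ L ρ(x, y) < m + 1`. The ball condition bounds the `m`-th
contribution by `κ L^(-α) (m + 1)^(α - N)`, and `N ≥ α + 2` leaves the series `∑ (m + 1)⁻² = π²/6 ≤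
2`. -/
lemma integral_inv_one_add_pow_le {X : Type*} [MetricSpace X] [MeasurableSpace X] [BorelSpace X]
    {μ : Measure X} [IsFiniteMeasure μ] {α κ : ℝ} (hκ : 0 < κ)
    (hball : ∀ (x : X) (r : ℝ), 0 < r → μ.real (Metric.closedBall x r) ≤ κ * r ^ α)
    {N : ℕ} (hN : α + 2 ≤ N) {L : ℝ} (hL : 0 < L) (x : X) :
    ∫ y, ((1 + L * dist x y) ^ N)⁻¹ ∂μ ≤ 2 * κ * L ^ (-α) := by
  have hmeas : Measurable fun y => ((1 + L * dist x y) ^ N)⁻¹ := by fun_prop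
  rw [integral_eq_lintegral_of_nonneg_ae (.of_forall fun y => by positivity)
    hmeas.aestronglyMeasurable]
  refine ENNReal.toReal_le_of_le_ofReal (by positivity) ?_
  have hsum2 : HasSum (fun m : ℕ => 1 / ((m : ℝ) + 1) ^ 2) (Real.pi ^ 2 / 6) := by
    have := (hasSum_nat_add_iff' 1).2 hasSum_zeta_two
    simpa using this
  have hpi : Real.pi ^ 2 / 6 ≤ 2 := by nlinarith [Real.pi_lt_d2, Real.pi_pos]
  calc ∫⁻ y, ENNReal.ofReal (((1 + L * dist x y) ^ N)⁻¹) ∂μ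
      ≤ ∫⁻ y, ∑' m : ℕ, (Metric.closedBall x ((m + 1) / L)).indicator
          (fun _ => ENNReal.ofReal ((((m : ℝ) + 1) ^ N)⁻¹)) y ∂μ := by
        refine lintegral_mono fun y => ?_
        set m := ⌊L * dist x y⌋₊
        refine le_trans ?_ (ENNReal.le_tsum m)
        have h1 : (m : ℝ) ≤ L * dist x y := Nat.floor_le (by positivity)
        have h2 : L * dist x y < m + 1 := Nat.lt_floor_add_one _
        rw [Set.indicator_of_mem]
        · apply ENNReal.ofReal_le_ofReal
          refine inv_anti₀ (by positivity) (pow_le_pow_left₀ (by positivity) (by linarith) _)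
        · rw [Metric.mem_closedBall, dist_comm, le_div_iff₀ hL]
          linarith
    _ = ∑' m : ℕ, ENNReal.ofReal ((((m : ℝ) + 1) ^ N)⁻¹) *
          μ (Metric.closedBall x ((m + 1) / L)) := by
        rw [lintegral_tsum]
        · congr with m
          rw [lintegral_indicator_const Metric.isClosed_closedBall.measurableSet]
        · intro m
          exact (measurable_const.indicator Metric.isClosed_closedBall.measurableSet).aemeasurable
    _ ≤ ∑' m : ℕ, ENNReal.ofReal (κ * L ^ (-α) * (1 / ((m : ℝ) + 1) ^ 2)) := by
        refine ENNReal.tsum_le_tsum fun m => ?_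
        have hm : (0 : ℝ) < m + 1 := by positivity
        rw [← ofReal_measureReal (measure_ne_top _ _), ← ENNReal.ofReal_mul (by positivity)]
        apply ENNReal.ofReal_le_ofReal
        calc (((m : ℝ) + 1) ^ N)⁻¹ * μ.real (Metric.closedBall x ((m + 1) / L))
            ≤ (((m : ℝ) + 1) ^ N)⁻¹ * (κ * (((m : ℝ) + 1) / L) ^ α) := by
              gcongr; exact hball _ _ (by positivity)
          _ = κ * L ^ (-α) * (((m : ℝ) + 1) ^ (α - N)) := by
              rw [Real.div_rpow hm.le hL.le, Real.rpow_neg hL.le, Real.rpow_sub hm,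
                Real.rpow_natCast]
              field_simp
          _ ≤ κ * L ^ (-α) * (((m : ℝ) + 1) ^ (-2 : ℝ)) := by
              gcongr
              · linarith [(Nat.cast_nonneg m : (0 : ℝ) ≤ m)]
              · linarith
          _ = _ := by
              rw [Real.rpow_neg hm.le, one_div]; norm_cast
    _ = ENNReal.ofReal (κ * L ^ (-α) * (Real.pi ^ 2 / 6)) := by
        rw [← ENNReal.ofReal_tsum_of_nonneg (fun m => by positivity)
          (hsum2.summable.mul_left _), tsum_mul_left, hsum2.tsum_eq]
    _ ≤ _ := by
        apply ENNReal.ofReal_le_ofReal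
        have : 0 < κ * L ^ (-α) := by positivity
        nlinarith

/-! ### Weighted bounds for `exp (c T)` by commutators. -/

section Commutator

variable {E H : Type*} [NormedAddCommGroup E] [NormedSpace ℂ E]
  [NormedAddCommGroup H] [InnerProductSpace ℂ H]

lemma hasSum_exp_smul_apply [CompleteSpace E] (T : E →L[ℂ] E) (c : ℂ) (f : E) :
    HasSum (fun n : ℕ => ((n.factorial : ℂ)⁻¹ * c ^ n) • (T ^ n) f)
      (NormedSpace.exp (c • T) f) := by
  have h := NormedSpace.exp_series_hasSum_exp' (𝕂 := ℂ) (c • T)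
  have h2 := h.mapL (ContinuousLinearMap.apply ℂ E f)
  simpa [smul_pow, mul_smul] using h2

lemma exp_smul_apply_of_eigenvector [CompleteSpace E] {T : E →L[ℂ] E} {lam : ℂ} {f : E} (h : T f = lam • f)
    (c : ℂ) : NormedSpace.exp (c • T) f = Complex.exp (c * lam) • f := by
  have hpow : ∀ n : ℕ, (T ^ n) f = lam ^ n • f := by
    intro n
    induction n with
    | zero => simp
    | succ n ih => rw [pow_succ', mul_apply_eq_comp, ih, map_smul, h, smul_smul,
        ← pow_succ]
  have h1 := hasSum_exp_smul_apply T c f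
  have h2 : HasSum (fun n : ℕ => (n.factorial : ℂ)⁻¹ * (c * lam) ^ n) (Complex.exp (c * lam)) := by
    have := NormedSpace.exp_series_hasSum_exp' (𝕂 := ℂ) (c * lam)
    rw [← Complex.exp_eq_exp_ℂ] at this
    simpa using this
  refine h1.unique ((h2.smul_const f).congr_fun ?_)
  intro n
  rw [hpow, smul_smul, mul_pow, mul_assoc]

variable {J : E →L[ℂ] H} {T : E →L[ℂ] E}

/-- The exponential lives in the bounded operators on `E` (later the continuous functions with the
supremum norm), whereas `T` is symmetric only for the inner product pulled back along `J` (later the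
map into `L²`). The adjoint is therefore computed term by term in the series. -/
lemma inner_exp_smul_left [CompleteSpace E] (hsymm : ∀ f g, inner ℂ (J (T f)) (J g) = inner ℂ (J f) (J (T g)))
    (c : ℂ) (f g : E) :
    inner ℂ (J (NormedSpace.exp (c • T) f)) (J g) =
      inner ℂ (J f) (J (NormedSpace.exp (conj c • T) g)) := by
  have hpow : ∀ (n : ℕ) (f g : E),
      inner ℂ (J ((T ^ n) f)) (J g) = inner ℂ (J f) (J ((T ^ n) g)) := by
    intro n
    induction n with
    | zero => simp
    | succ n ih =>
      intro f g
      rw [pow_succ', mul_apply_eq_comp, hsymm, ih, ← mul_apply_eq_comp,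
        ← pow_succ, pow_succ']
  have h1 : HasSum (fun n : ℕ => inner ℂ (J g) (J (((n.factorial : ℂ)⁻¹ * c ^ n) • (T ^ n) f)))
      (inner ℂ (J g) (J (NormedSpace.exp (c • T) f))) :=
    (hasSum_exp_smul_apply T c f).mapL ((innerSL ℂ (J g)).comp J)
  have h2 : HasSum
      (fun n : ℕ => inner ℂ (J f) (J (((n.factorial : ℂ)⁻¹ * (conj c) ^ n) • (T ^ n) g)))
      (inner ℂ (J f) (J (NormedSpace.exp (conj c • T) g))) :=
    (hasSum_exp_smul_apply T (conj c) g).mapL ((innerSL ℂ (J f)).comp J)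
  have h3 := (Complex.hasSum_conj'.2 h1)
  rw [inner_conj_symm] at h3
  refine h3.unique (h2.congr_fun ?_)
  intro n
  rw [inner_conj_symm, map_smul, map_smul, inner_smul_left, inner_smul_right, hpow]
  simp

lemma norm_exp_smul_apply [CompleteSpace E] (hsymm : ∀ f g, inner ℂ (J (T f)) (J g) = inner ℂ (J f) (J (T g)))
    {c : ℂ} (hc : conj c = -c) (f : E) : ‖J (NormedSpace.exp (c • T) f)‖ = ‖J f‖ := by
  have h := inner_exp_smul_left hsymm c f (NormedSpace.exp (c • T) f)
  have h2 : NormedSpace.exp (conj c • T) (NormedSpace.exp (c • T) f) = f := by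
    let _ : NormedAlgebra ℚ (E →L[ℂ] E) := NormedAlgebra.restrictScalars ℚ ℂ _
    rw [hc, ← mul_apply_eq_comp, ← NormedSpace.exp_add_of_commute]
    · simp
    · exact ((Commute.refl T).smul_left _).smul_right _
  rw [h2, inner_self_eq_norm_sq_to_K, inner_self_eq_norm_sq_to_K] at h
  have h3 : ‖J (NormedSpace.exp (c • T) f)‖ ^ 2 = ‖J f‖ ^ 2 := by exact_mod_cast h
  exact (pow_left_inj₀ (norm_nonneg _) (norm_nonneg _) two_ne_zero).1 h3

variable {W : ℕ → E →L[ℂ] E} {A : ℝ} {N : ℕ}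

/-- Write `W T = [W, T] + T W`. The commutator term carries a lower weight, which monotonicity
absorbs. -/
lemma norm_weight_apply_le (hA : 0 ≤ A) (hW0 : W 0 = 1) (hT : ∀ f, ‖J (T f)‖ ≤ A * ‖J f‖)
    (hmono : ∀ k f, ‖J (W k f)‖ ≤ ‖J (W (k + 1) f)‖)
    (hcomm : ∀ k < N, ∀ f, ‖J (W (k + 1) (T f) - T (W (k + 1) f))‖ ≤ A * ‖J (W k f)‖)
    {k : ℕ} (hk : k ≤ N) (f : E) : ‖J (W k (T f))‖ ≤ 2 * A * ‖J (W k f)‖ := by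
  cases k with
  | zero =>
    rw [hW0]
    exact (hT f).trans (by
      have : 0 ≤ A * ‖J f‖ := by positivity
      simp only [one_apply_eq_self]
      linarith)
  | succ k =>
    have h1 : J (W (k + 1) (T f)) =
        J (W (k + 1) (T f) - T (W (k + 1) f)) + J (T (W (k + 1) f)) := by
      rw [map_sub, sub_add_cancel]
    rw [h1]
    refine (norm_add_le _ _).trans ?_
    have h2 := hcomm k hk f
    have h3 := hT (W (k + 1) f)
    have h4 := mul_le_mul_of_nonneg_left (hmono k f) hA
    linarith

lemma norm_weight_pow_le (hA : 0 ≤ A) (hW0 : W 0 = 1) (hT : ∀ f, ‖J (T f)‖ ≤ A * ‖J f‖)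
    (hmono : ∀ k f, ‖J (W k f)‖ ≤ ‖J (W (k + 1) f)‖)
    (hcomm : ∀ k < N, ∀ f, ‖J (W (k + 1) (T f) - T (W (k + 1) f))‖ ≤ A * ‖J (W k f)‖)
    {k : ℕ} (hk : k ≤ N) (m : ℕ) (f : E) :
    ‖J (W k ((T ^ m) f))‖ ≤ (2 * A) ^ m * ‖J (W k f)‖ := by
  induction m with
  | zero => simp
  | succ m ih =>
    rw [pow_succ', mul_apply_eq_comp]
    refine (norm_weight_apply_le hA hW0 hT hmono hcomm hk _).trans ?_
    calc 2 * A * ‖J (W k ((T ^ m) f))‖ ≤ 2 * A * ((2 * A) ^ m * ‖J (W k f)‖) := by gcongr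
      _ = _ := by ring

/-- By `[W, T^(m+1)] = [W, T] T^m + T [W, T^m]`, the loss is one power of the weight for every `m`.
The base `4 A` leaves room for the sum of the two terms, so the exponential series can be summed
next. -/
lemma norm_commutator_pow_le (hA : 0 ≤ A) (hW0 : W 0 = 1) (hT : ∀ f, ‖J (T f)‖ ≤ A * ‖J f‖)
    (hmono : ∀ k f, ‖J (W k f)‖ ≤ ‖J (W (k + 1) f)‖)
    (hcomm : ∀ k < N, ∀ f, ‖J (W (k + 1) (T f) - T (W (k + 1) f))‖ ≤ A * ‖J (W k f)‖)
    {k : ℕ} (hk : k < N) (m : ℕ) (f : E) :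
    ‖J (W (k + 1) ((T ^ m) f) - (T ^ m) (W (k + 1) f))‖ ≤ (4 * A) ^ m * ‖J (W k f)‖ := by
  induction m with
  | zero => simp
  | succ m ih =>
    have h1 : J (W (k + 1) ((T ^ (m + 1)) f) - (T ^ (m + 1)) (W (k + 1) f)) =
        J (W (k + 1) (T ((T ^ m) f)) - T (W (k + 1) ((T ^ m) f))) +
        J (T (W (k + 1) ((T ^ m) f) - (T ^ m) (W (k + 1) f))) := by
      rw [pow_succ', mul_apply_eq_comp, mul_apply_eq_comp, ← map_add,
        map_sub T, sub_add_sub_cancel]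
    rw [h1]
    calc _ ≤ A * ((2 * A) ^ m * ‖J (W k f)‖) + A * ((4 * A) ^ m * ‖J (W k f)‖) := by
          refine (norm_add_le _ _).trans (add_le_add ?_ ?_)
          · refine (hcomm k hk _).trans ?_
            gcongr
            exact norm_weight_pow_le hA hW0 hT hmono hcomm hk.le m f
          · refine (hT _).trans ?_
            gcongr
      _ ≤ A * ((4 * A) ^ m * ‖J (W k f)‖) + A * ((4 * A) ^ m * ‖J (W k f)‖) := by
          gcongr; norm_num
      _ ≤ (4 * A) ^ (m + 1) * ‖J (W k f)‖ := by
          have : 0 ≤ A * ((4 * A) ^ m * ‖J (W k f)‖) := by positivity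
          rw [pow_succ]
          linarith

lemma norm_commutator_exp_le [CompleteSpace E] (hA : 0 ≤ A) (hW0 : W 0 = 1) (hT : ∀ f, ‖J (T f)‖ ≤ A * ‖J f‖)
    (hmono : ∀ k f, ‖J (W k f)‖ ≤ ‖J (W (k + 1) f)‖)
    (hcomm : ∀ k < N, ∀ f, ‖J (W (k + 1) (T f) - T (W (k + 1) f))‖ ≤ A * ‖J (W k f)‖)
    {k : ℕ} (hk : k < N) (c : ℂ) (f : E) :
    ‖J (W (k + 1) (NormedSpace.exp (c • T) f) - NormedSpace.exp (c • T) (W (k + 1) f))‖ ≤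
      Real.exp (4 * A * ‖c‖) * ‖J (W k f)‖ := by
  have h1 := ((hasSum_exp_smul_apply T c f).mapL (W (k + 1))).sub
    (hasSum_exp_smul_apply T c (W (k + 1) f))
  have h2 := h1.mapL J
  have h3 : HasSum (fun n : ℕ => (n.factorial : ℝ)⁻¹ * (4 * A * ‖c‖) ^ n * ‖J (W k f)‖)
      (Real.exp (4 * A * ‖c‖) * ‖J (W k f)‖) := by
    have := NormedSpace.exp_series_hasSum_exp' (𝕂 := ℝ) (4 * A * ‖c‖)
    rw [← Real.exp_eq_exp_ℝ] at this
    simpa using this.mul_right (‖J (W k f)‖)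
  refine h2.norm_le_of_bounded h3 fun n => ?_
  rw [map_smul, ← smul_sub, map_smul, norm_smul]
  have := norm_commutator_pow_le hA hW0 hT hmono hcomm hk n f
  calc _ ≤ ‖(n.factorial : ℂ)⁻¹ * c ^ n‖ * ((4 * A) ^ n * ‖J (W k f)‖) := by gcongr
    _ = _ := by
      rw [norm_mul, norm_inv, norm_pow, Complex.norm_natCast]; ring

/-- Polynomial growth of the powers of `exp (c T)` in weighted spaces, for imaginary `c`. -/
lemma norm_weight_exp_pow_le [CompleteSpace E] (hsymm : ∀ f g, inner ℂ (J (T f)) (J g) = inner ℂ (J f) (J (T g)))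
    (hA : 0 ≤ A) (hW0 : W 0 = 1) (hT : ∀ f, ‖J (T f)‖ ≤ A * ‖J f‖)
    (hmono : ∀ k f, ‖J (W k f)‖ ≤ ‖J (W (k + 1) f)‖)
    (hcomm : ∀ k < N, ∀ f, ‖J (W (k + 1) (T f) - T (W (k + 1) f))‖ ≤ A * ‖J (W k f)‖)
    {c : ℂ} (hc : conj c = -c) {k : ℕ} (hk : k ≤ N) (n : ℕ) (f : E) :
    ‖J (W k ((NormedSpace.exp (c • T) ^ n) f))‖ ≤
      (1 + n * Real.exp (4 * A * ‖c‖)) ^ k * ‖J (W k f)‖ := by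
  set V := NormedSpace.exp (c • T) with hV
  set B := Real.exp (4 * A * ‖c‖) with hB
  have hB0 : 0 < B := Real.exp_pos _
  induction k generalizing n with
  | zero =>
    rw [hW0]
    simp only [one_apply_eq_self, pow_zero, one_mul]
    induction n with
    | zero => simp
    | succ n ih =>
      rw [pow_succ', mul_apply_eq_comp, hV, norm_exp_smul_apply hsymm hc]
      exact ih
  | succ k ihk =>
    -- As `V` is isometric after `J`, each further factor `V` only adds one commutator term, of
    -- weight `k`, which the outer induction bounds. The growth in `m` is thus additive; with `b = n
    -- B` the total `(1 + b)^k + b (1 + b)^k` is the next power.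
    have key : ∀ m ≤ n, ‖J (W (k + 1) ((V ^ m) f))‖ ≤
        ‖J (W (k + 1) f)‖ + m * (B * ((1 + n * B) ^ k * ‖J (W k f)‖)) := by
      intro m
      induction m with
      | zero => simp
      | succ m ih =>
        intro hm
        have h1 : J (W (k + 1) ((V ^ (m + 1)) f)) =
            J (W (k + 1) (V ((V ^ m) f)) - V (W (k + 1) ((V ^ m) f))) +
            J (V (W (k + 1) ((V ^ m) f))) := by
          rw [map_sub, sub_add_cancel, pow_succ', mul_apply_eq_comp]
        have h2 := norm_commutator_exp_le hA hW0 hT hmono hcomm hk c ((V ^ m) f)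
        have h3 : ‖J (V (W (k + 1) ((V ^ m) f)))‖ = ‖J (W (k + 1) ((V ^ m) f))‖ :=
          norm_exp_smul_apply hsymm hc _
        have h4 : ‖J (W k ((V ^ m) f))‖ ≤ (1 + n * B) ^ k * ‖J (W k f)‖ := by
          refine (ihk (by omega) m).trans ?_
          have : (m : ℝ) ≤ n := by exact_mod_cast (by omega : m ≤ n)
          gcongr
        have h5 := mul_le_mul_of_nonneg_left h4 hB0.le
        have h6 := ih (by omega)
        rw [h1]
        refine (norm_add_le _ _).trans ?_
        rw [h3]
        rw [Nat.cast_add, Nat.cast_one]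
        linarith
    refine (key n le_rfl).trans ?_
    have h7 : (1 : ℝ) ≤ (1 + n * B) ^ k := one_le_pow₀ (by
      have : 0 ≤ n * B := by positivity
      linarith)
    have h8 := hmono k f
    calc ‖J (W (k + 1) f)‖ + n * (B * ((1 + n * B) ^ k * ‖J (W k f)‖))
        ≤ (1 + n * B) ^ k * ‖J (W (k + 1) f)‖ +
          n * (B * ((1 + n * B) ^ k * ‖J (W (k + 1) f)‖)) := by
          gcongr
          exact le_mul_of_one_le_left (norm_nonneg _) h7
      _ = _ := by ring

end Commutator

/-! ### The weights `(1 + L ρ(x, ·))^m` and the scale-invariant decay kernel. -/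

section Weights

variable {X : Type*} [MetricSpace X]

/-- Multiplication by `(1 + L ρ(x, ·)) ^ m`. -/
noncomputable def distWeight (L : ℝ) (x : X) (m : ℕ) : C(X, ℂ) :=
  ⟨fun y => (((1 + L * dist x y) ^ m : ℝ) : ℂ), by fun_prop⟩

lemma distWeight_apply (L : ℝ) (x : X) (m : ℕ) (y : X) :
    distWeight L x m y = (((1 + L * dist x y) ^ m : ℝ) : ℂ) := rfl

lemma norm_distWeight {L : ℝ} (hL : 0 < L) (x : X) (m : ℕ) (y : X) :
    ‖distWeight L x m y‖ = (1 + L * dist x y) ^ m := by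
  rw [distWeight_apply, Complex.norm_real, Real.norm_of_nonneg (by positivity)]

lemma one_add_mul_dist_le {L : ℝ} (hL : 0 < L) (x y z : X) :
    1 + L * dist x y ≤ (1 + L * dist x z) * (1 + L * dist z y) := by
  have h1 := mul_le_mul_of_nonneg_left (dist_triangle x z y) hL.le
  have h2 : 0 ≤ L * dist x z * (L * dist z y) := by positivity
  nlinarith

/-- This is where a power of the weight is gained: the difference of the bases is at most `L ρ(y,
z)`, with no factor depending on `x`. The powers of `1 + L ρ(y, z)` are left for the decay of the
kernel to absorb. -/
lemma abs_weight_sub_le {L : ℝ} (hL : 0 < L) (x y z : X) (m : ℕ) :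
    |(1 + L * dist x y) ^ (m + 1) - (1 + L * dist x z) ^ (m + 1)| ≤
      (m + 1) * (1 + L * dist y z) ^ (m + 1) * (1 + L * dist x z) ^ m := by
  have h1 : |(1 + L * dist x y) - (1 + L * dist x z)| ≤ 1 + L * dist y z := by
    have := abs_dist_sub_le y z x
    rw [dist_comm y x, dist_comm z x] at this
    rw [add_sub_add_left_eq_sub, ← mul_sub, abs_mul, abs_of_pos hL]
    nlinarith
  have h2 : max |1 + L * dist x y| |1 + L * dist x z| ≤
      (1 + L * dist x z) * (1 + L * dist y z) := by
    rw [abs_of_pos (by positivity), abs_of_pos (by positivity)]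
    refine max_le ?_ (le_mul_of_one_le_right (by positivity) ?_)
    · rw [dist_comm y z]; exact one_add_mul_dist_le hL x y z
    · have : 0 ≤ L * dist y z := by positivity
      linarith
  calc _ ≤ |(1 + L * dist x y) - (1 + L * dist x z)| * ((m + 1 : ℕ) : ℝ) *
        max |1 + L * dist x y| |1 + L * dist x z| ^ m := by
        simpa using abs_pow_sub_pow_le (1 + L * dist x y) (1 + L * dist x z) (m + 1)
    _ ≤ (1 + L * dist y z) * ((m + 1 : ℕ) : ℝ) *
        ((1 + L * dist x z) * (1 + L * dist y z)) ^ m := by gcongr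
    _ = _ := by push_cast; rw [mul_pow]; ring

lemma schur_row_le [MeasurableSpace X] [BorelSpace X] (μ : Measure X) [IsFiniteMeasure μ]
    {α κ : ℝ} {N : ℕ} (hκ : 0 < κ)
    (hball : ∀ (x : X) (r : ℝ), 0 < r → μ.real (Metric.closedBall x r) ≤ κ * r ^ α)
    (hN : α + 2 ≤ N) {L : ℝ} (hL : 0 < L) {c : ℝ} (hc : 0 ≤ c) (x : X) :
    ∫ y, c * L ^ α * ((1 + L * dist x y) ^ N)⁻¹ ∂μ ≤ 2 * κ * c := by
  rw [integral_const_mul]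
  calc _ ≤ c * L ^ α * (2 * κ * L ^ (-α)) := by
        gcongr; exact integral_inv_one_add_pow_le hκ hball hN hL x
    _ = _ := by rw [Real.rpow_neg hL.le]; field_simp

lemma continuous_decay {α L : ℝ} (hL : 0 < L) (c : ℝ) (N : ℕ) :
    Continuous fun z : X × X => c * L ^ α * ((1 + L * dist z.1 z.2) ^ N)⁻¹ := by
  refine continuous_const.mul (Continuous.inv₀ (by fun_prop) fun z => ?_)
  positivity

end Weights

lemma continuous_kernel {X : Type*} [MetricSpace X] [CompactSpace X] (k : C(X, C(X, ℂ))) : Continuous fun z : X × X => k z.1 z.2 :=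
  ContinuousEval.continuous_eval.comp ((k.continuous.comp continuous_fst).prodMk continuous_snd)

/-! ### Integral operators on continuous functions, measured in `L²(μ)`. -/

section IntegralOperator

variable {X : Type*} [MetricSpace X] [CompactSpace X] [MeasurableSpace X] [BorelSpace X]
  (μ : Measure X) [IsFiniteMeasure μ]

/-- The embedding of the continuous functions into `L²(μ)`. -/
noncomputable def toL2 : C(X, ℂ) →L[ℂ] Lp ℂ 2 μ := ContinuousMap.toLp 2 μ ℂ

lemma inner_toL2 (f g : C(X, ℂ)) :
    inner ℂ (toL2 μ f) (toL2 μ g) = ∫ x, g x * conj (f x) ∂μ :=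
  ContinuousMap.inner_toLp μ f g

lemma norm_toL2_sq (f : C(X, ℂ)) : ‖toL2 μ f‖ ^ 2 = ∫ x, ‖f x‖ ^ 2 ∂μ := by
  have h : ((‖toL2 μ f‖ ^ 2 : ℝ) : ℂ) = ((∫ x, ‖f x‖ ^ 2 ∂μ : ℝ) : ℂ) := by
    have h1 := inner_self_eq_norm_sq_to_K (𝕜 := ℂ) (toL2 μ f)
    rw [inner_toL2] at h1
    rw [← integral_complex_ofReal]
    push_cast
    rw [← RCLike.ofReal_eq_complex_ofReal, ← h1]
    congr with x
    rw [RCLike.mul_conj]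
  exact_mod_cast h

lemma norm_toL2_le_of_forall_le {f g : C(X, ℂ)} (h : ∀ x, ‖f x‖ ≤ ‖g x‖) :
    ‖toL2 μ f‖ ≤ ‖toL2 μ g‖ := by
  rw [← pow_le_pow_iff_left₀ (norm_nonneg _) (norm_nonneg _) two_ne_zero, norm_toL2_sq,
    norm_toL2_sq]
  exact integral_mono ((f.continuous.norm.pow 2).integrable_of_compactSpace μ)
    ((g.continuous.norm.pow 2).integrable_of_compactSpace μ)
    fun x => pow_le_pow_left₀ (norm_nonneg _) (h x) 2

lemma norm_toL2_le_of_schur {D : X → X → ℝ} (hD : Continuous fun z : X × X => D z.1 z.2)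
    (hD0 : ∀ x y, 0 ≤ D x y) {A : ℝ} (hA : 0 < A) (hrow : ∀ x, ∫ y, D x y ∂μ ≤ A)
    (hcol : ∀ y, ∫ x, D x y ∂μ ≤ A) {f g : C(X, ℂ)}
    (h : ∀ x, ‖f x‖ ≤ ∫ y, D x y * ‖g y‖ ∂μ) : ‖toL2 μ f‖ ≤ A * ‖toL2 μ g‖ := by
  rw [← pow_le_pow_iff_left₀ (norm_nonneg _) (by positivity) two_ne_zero, mul_pow, norm_toL2_sq,
    norm_toL2_sq]
  have key := integral_rpow_integral_mul_le (μ := μ) hD hD0 g.continuous.norm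
    (fun _ => norm_nonneg _) hA one_le_two hrow hcol
  simp only [Real.rpow_two] at key
  refine le_trans ?_ key
  exact integral_mono ((f.continuous.norm.pow 2).integrable_of_compactSpace μ)
    (((continuous_integral_mul hD g.continuous.norm).pow 2).integrable_of_compactSpace μ)
    fun x => pow_le_pow_left₀ (norm_nonneg _) (h x) 2

/-- The operator `f ↦ (x ↦ ∫ f(y) conj (k x y) dμ(y))` on continuous functions. -/
noncomputable def integralOp (k : C(X, C(X, ℂ))) : C(X, ℂ) →L[ℂ] C(X, ℂ) :=
  LinearMap.mkContinuous
    { toFun := fun f =>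
        ⟨fun x => inner ℂ (toL2 μ (k x)) (toL2 μ f),
          Continuous.inner ((toL2 μ).continuous.comp k.continuous) continuous_const⟩
      map_add' := fun f g => by ext x; simp [inner_add_right]
      map_smul' := fun c f => by ext x; simp [inner_smul_right] }
    (‖toL2 μ‖ * ‖k‖ * ‖toL2 μ‖) fun f => by
      refine (ContinuousMap.norm_le _ (by positivity)).2 fun x => ?_
      refine (norm_inner_le_norm (𝕜 := ℂ) (toL2 μ (k x)) (toL2 μ f)).trans ?_
      rw [mul_assoc]
      gcongr
      · exact ((toL2 μ).le_opNorm _).trans (by gcongr; exact k.norm_coe_le_norm x)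
      · exact (toL2 μ).le_opNorm _

variable (k : C(X, C(X, ℂ)))

lemma integralOp_eq_inner (f : C(X, ℂ)) (x : X) :
    integralOp μ k f x = inner ℂ (toL2 μ (k x)) (toL2 μ f) := rfl

lemma integralOp_apply (f : C(X, ℂ)) (x : X) :
    integralOp μ k f x = ∫ y, f y * conj (k x y) ∂μ := inner_toL2 μ _ _

variable {k}

lemma inner_integralOp_left (hk : ∀ x y, k x y = conj (k y x)) (f g : C(X, ℂ)) :
    inner ℂ (toL2 μ (integralOp μ k f)) (toL2 μ g) =
      inner ℂ (toL2 μ f) (toL2 μ (integralOp μ k g)) := by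
  have hc : Continuous fun z : X × X => g z.1 * (conj (f z.2) * k z.1 z.2) :=
    (g.continuous.comp continuous_fst).mul
      ((Complex.continuous_conj.comp (f.continuous.comp continuous_snd)).mul (continuous_kernel k))
  rw [inner_toL2, inner_toL2]
  calc ∫ x, g x * conj (integralOp μ k f x) ∂μ
      = ∫ x, ∫ y, g x * (conj (f y) * k x y) ∂μ ∂μ := by
        congr with x
        rw [integralOp_apply, ← integral_conj, ← integral_const_mul]
        simp
    _ = ∫ y, ∫ x, g x * (conj (f y) * k x y) ∂μ ∂μ :=
        integral_integral_swap (hc.integrable_of_compactSpace _)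
    _ = _ := by
        congr with y
        rw [integralOp_apply, ← integral_mul_const]
        congr with x
        rw [hk x y]; ring

/-! ### Kernels with polynomial decay at scale `1 / L`. -/

section Decay

variable {α κ C L : ℝ} {N : ℕ}

lemma norm_toL2_le_of_decay (hκ : 0 < κ)
    (hball : ∀ (x : X) (r : ℝ), 0 < r → μ.real (Metric.closedBall x r) ≤ κ * r ^ α)
    (hN : α + 2 ≤ N) (hL : 0 < L) {c : ℝ} (hc : 0 < c) {f g : C(X, ℂ)}
    (h : ∀ x, ‖f x‖ ≤ ∫ y, c * L ^ α * ((1 + L * dist x y) ^ N)⁻¹ * ‖g y‖ ∂μ) :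
    ‖toL2 μ f‖ ≤ 2 * κ * c * ‖toL2 μ g‖ := by
  refine norm_toL2_le_of_schur μ (continuous_decay hL c N) (fun x y => by positivity)
    (by positivity) (schur_row_le μ hκ hball hN hL hc.le) (fun y => ?_) h
  simp_rw [fun x => dist_comm x y]
  exact schur_row_le μ hκ hball hN hL hc.le y

/-- The factor `N + 1` is wasteful; it gives the same constant as for the commutator below, so that
a single `A` serves both. -/
lemma norm_toL2_integralOp_le (hκ : 0 < κ)
    (hball : ∀ (x : X) (r : ℝ), 0 < r → μ.real (Metric.closedBall x r) ≤ κ * r ^ α)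
    (hN : α + 2 ≤ N) (hL : 0 < L) (hC : 0 < C)
    (hdecay : ∀ x y, ‖k x y‖ ≤ C * L ^ α * ((1 + L * dist x y) ^ (2 * N))⁻¹) (f : C(X, ℂ)) :
    ‖toL2 μ (integralOp μ k f)‖ ≤ 2 * κ * ((N + 1) * C) * ‖toL2 μ f‖ := by
  refine norm_toL2_le_of_decay μ hκ hball hN hL (by positivity) fun x => ?_
  rw [integralOp_apply]
  refine norm_integral_le_of_norm_le ?_ (.of_forall fun y => ?_)
  · exact (((continuous_decay hL _ N).comp (Continuous.prodMk_right x)).mul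
      f.continuous.norm).integrable_of_compactSpace μ
  · rw [norm_mul, RCLike.norm_conj, mul_comm]
    gcongr
    refine (hdecay x y).trans ?_
    have h1 : 1 ≤ 1 + L * dist x y := by
      have : 0 ≤ L * dist x y := by positivity
      linarith
    gcongr
    · nlinarith [(Nat.cast_nonneg N : (0 : ℝ) ≤ N)]
    · omega

/-- The commutator has as kernel the difference of the weights times the kernel of the operator. Of
the `2 N` powers of decay, `N` absorb the factor `(1 + L ρ(y, z))^(m+1)` and `N` remain for Schur's
test. -/
lemma norm_toL2_commutator_le (hκ : 0 < κ)
    (hball : ∀ (x : X) (r : ℝ), 0 < r → μ.real (Metric.closedBall x r) ≤ κ * r ^ α)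
    (hN : α + 2 ≤ N) (hL : 0 < L) (hC : 0 < C)
    (hdecay : ∀ x y, ‖k x y‖ ≤ C * L ^ α * ((1 + L * dist x y) ^ (2 * N))⁻¹) (x : X)
    {m : ℕ} (hm : m < N) (f : C(X, ℂ)) :
    ‖toL2 μ (distWeight L x (m + 1) * integralOp μ k f -
      integralOp μ k (distWeight L x (m + 1) * f))‖ ≤
      2 * κ * ((N + 1) * C) * ‖toL2 μ (distWeight L x m * f)‖ := by
  refine norm_toL2_le_of_decay μ hκ hball hN hL (by positivity) fun y => ?_
  have e1 : (distWeight L x (m + 1) * integralOp μ k f -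
      integralOp μ k (distWeight L x (m + 1) * f)) y =
      ∫ z, (distWeight L x (m + 1) y - distWeight L x (m + 1) z) * (f z * conj (k y z)) ∂μ := by
    have i1 : Integrable (fun z => distWeight L x (m + 1) y * (f z * conj (k y z))) μ :=
      (continuous_const.mul (f.continuous.mul
        (Complex.continuous_conj.comp (k y).continuous))).integrable_of_compactSpace μ
    have i2 : Integrable (fun z => distWeight L x (m + 1) z * (f z * conj (k y z))) μ :=
      ((distWeight L x (m + 1)).continuous.mul (f.continuous.mul
        (Complex.continuous_conj.comp (k y).continuous))).integrable_of_compactSpace μ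
    simp only [sub_mul]
    rw [integral_sub i1 i2, integral_const_mul, ContinuousMap.sub_apply, ContinuousMap.mul_apply,
      integralOp_apply, integralOp_apply]
    simp only [ContinuousMap.mul_apply, mul_assoc]
  rw [e1]
  refine norm_integral_le_of_norm_le ?_ (.of_forall fun z => ?_)
  · exact (((continuous_decay hL _ N).comp (Continuous.prodMk_right y)).mul
      (distWeight L x m * f).continuous.norm).integrable_of_compactSpace μ
  · rw [norm_mul, norm_mul, RCLike.norm_conj, ContinuousMap.mul_apply, norm_mul,
      norm_distWeight hL, distWeight_apply, distWeight_apply, ← Complex.ofReal_sub,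
      Complex.norm_real, Real.norm_eq_abs]
    have h1 : 1 ≤ 1 + L * dist y z := by
      have : 0 ≤ L * dist y z := by positivity
      linarith
    have hmN : (m : ℝ) ≤ N := by exact_mod_cast hm.le
    calc _ ≤ ((m + 1) * (1 + L * dist y z) ^ (m + 1) * (1 + L * dist x z) ^ m) *
          (‖f z‖ * (C * L ^ α * ((1 + L * dist y z) ^ (2 * N))⁻¹)) := by
          gcongr
          · exact abs_weight_sub_le hL x y z m
          · exact hdecay y z
      _ ≤ ((N + 1) * (1 + L * dist y z) ^ N * (1 + L * dist x z) ^ m) *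
          (‖f z‖ * (C * L ^ α * ((1 + L * dist y z) ^ (2 * N))⁻¹)) := by
          gcongr
          omega
      _ = _ := by
          rw [two_mul N, pow_add]
          field_simp

/-- Cauchy-Schwarz against the integrable weight. -/
lemma integral_norm_le_weighted (hκ : 0 < κ)
    (hball : ∀ (x : X) (r : ℝ), 0 < r → μ.real (Metric.closedBall x r) ≤ κ * r ^ α)
    (hN : α + 2 ≤ N) (hL : 0 < L) (x : X) (g : C(X, ℂ)) :
    (∫ y, ‖g y‖ ∂μ) ^ 2 ≤ 2 * κ * L ^ (-α) * ‖toL2 μ (distWeight L x N * g)‖ ^ 2 := by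
  have hpos : ∀ y, 0 < 1 + L * dist x y := fun y => by positivity
  let u : C(X, ℂ) := ⟨fun y => ((((1 + L * dist x y) ^ N)⁻¹ : ℝ) : ℂ),
    Complex.continuous_ofReal.comp (Continuous.inv₀ (by fun_prop) fun y => (pow_pos (hpos y) N).ne')⟩
  let v : C(X, ℂ) := ⟨fun y => (((1 + L * dist x y) ^ N * ‖g y‖ : ℝ) : ℂ), by fun_prop⟩
  have h1 : ‖toL2 μ v‖ ≤ ‖toL2 μ (distWeight L x N * g)‖ := by
    refine norm_toL2_le_of_forall_le μ fun y => ?_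
    rw [ContinuousMap.mul_apply, norm_mul, norm_distWeight hL]
    simp only [v, ContinuousMap.coe_mk, Complex.norm_real]
    rw [Real.norm_of_nonneg (by have := hpos y; positivity)]
  have h2 : ‖toL2 μ u‖ ^ 2 ≤ 2 * κ * L ^ (-α) := by
    rw [norm_toL2_sq]
    refine le_trans (integral_mono ((u.continuous.norm.pow 2).integrable_of_compactSpace μ)
      (Continuous.integrable_of_compactSpace ?_ μ) fun y => ?_)
      (integral_inv_one_add_pow_le hκ hball hN hL x)
    · exact Continuous.inv₀ (by fun_prop) fun y => (pow_pos (hpos y) N).ne'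
    · simp only [u, ContinuousMap.coe_mk, Complex.norm_real]
      have h3 : (1 : ℝ) ≤ (1 + L * dist x y) ^ N := one_le_pow₀ (by
        have : 0 ≤ L * dist x y := by positivity
        linarith)
      rw [Real.norm_of_nonneg (by positivity), sq]
      exact mul_le_of_le_one_right (by positivity) (inv_le_one_of_one_le₀ h3)
  have h4 : ∫ y, ‖g y‖ ∂μ = ‖(inner ℂ (toL2 μ u) (toL2 μ v) : ℂ)‖ := by
    rw [inner_toL2]
    have : ∀ y, v y * conj (u y) = ((‖g y‖ : ℝ) : ℂ) := by
      intro y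
      simp only [u, v, ContinuousMap.coe_mk, Complex.conj_ofReal]
      rw [← Complex.ofReal_mul]
      congr 1
      have := (pow_pos (hpos y) N).ne'
      field_simp
    simp_rw [this]
    rw [integral_complex_ofReal, Complex.norm_real,
      Real.norm_of_nonneg (integral_nonneg fun y => norm_nonneg _)]
  rw [h4]
  calc _ ≤ (‖toL2 μ u‖ * ‖toL2 μ v‖) ^ 2 := by gcongr; exact norm_inner_le_norm _ _
    _ = ‖toL2 μ u‖ ^ 2 * ‖toL2 μ v‖ ^ 2 := mul_pow _ _ _
    _ ≤ _ := by gcongr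

/-- The weight consumes half of the decay, and the rest is integrable. The factor `L^α` is later
cancelled by the `L^(-α)` from `integral_norm_le_weighted`. -/
lemma norm_toL2_weight_kernel_le (hκ : 0 < κ)
    (hball : ∀ (x : X) (r : ℝ), 0 < r → μ.real (Metric.closedBall x r) ≤ κ * r ^ α)
    (hN : α + 2 ≤ N) (hL : 0 < L) (hC : 0 < C)
    (hdecay : ∀ x y, ‖k x y‖ ≤ C * L ^ α * ((1 + L * dist x y) ^ (2 * N))⁻¹) (x : X) :
    ‖toL2 μ (distWeight L x N * k x)‖ ^ 2 ≤ 2 * κ * C ^ 2 * L ^ α := by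
  have hpos : ∀ y, 0 < 1 + L * dist x y := fun y => by positivity
  rw [norm_toL2_sq]
  calc _ ≤ ∫ y, (C * L ^ α) ^ 2 * ((1 + L * dist x y) ^ N)⁻¹ ∂μ := by
        refine integral_mono
          (((distWeight L x N * k x).continuous.norm.pow 2).integrable_of_compactSpace μ)
          (Integrable.const_mul (Continuous.integrable_of_compactSpace ?_ μ) _) fun y => ?_
        · exact Continuous.inv₀ (by fun_prop) fun y => (pow_pos (hpos y) N).ne'
        · simp only
          rw [ContinuousMap.mul_apply, norm_mul, norm_distWeight hL]
          have h3 : (1 : ℝ) ≤ (1 + L * dist x y) ^ N := one_le_pow₀ (by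
            have : 0 ≤ L * dist x y := by positivity
            linarith)
          calc _ ≤ ((1 + L * dist x y) ^ N *
                (C * L ^ α * ((1 + L * dist x y) ^ (2 * N))⁻¹)) ^ 2 := by
                gcongr; exact hdecay x y
            _ = (C * L ^ α) ^ 2 * (((1 + L * dist x y) ^ N)⁻¹ * ((1 + L * dist x y) ^ N)⁻¹) := by
                rw [two_mul N, pow_add]; field_simp
            _ ≤ _ := by
                gcongr
                exact mul_le_of_le_one_right (by positivity) (inv_le_one_of_one_le₀ h3)
    _ ≤ (C * L ^ α) ^ 2 * (2 * κ * L ^ (-α)) := by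
        rw [integral_const_mul]
        gcongr
        exact integral_inv_one_add_pow_le hκ hball hN hL x
    _ = _ := by rw [Real.rpow_neg hL.le]; field_simp

/-- Starting from `k x`, which is localized near `x`, the powers of the exponential cost a
polynomial factor in the weighted `L²` norm, the outer operator costs `2 A`, and Cauchy-Schwarz
returns to `L¹`. The powers of `L` cancel. -/
lemma integral_norm_integralOp_exp_pow_le (hk : ∀ x y, k x y = conj (k y x)) (hκ : 0 < κ)
    (hball : ∀ (x : X) (r : ℝ), 0 < r → μ.real (Metric.closedBall x r) ≤ κ * r ^ α)
    (hN : α + 2 ≤ N) (hL : 0 < L) (hC : 0 < C)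
    (hdecay : ∀ x y, ‖k x y‖ ≤ C * L ^ α * ((1 + L * dist x y) ^ (2 * N))⁻¹)
    {c : ℂ} (hc : conj c = -c) (n : ℕ) (x : X) :
    ∫ y, ‖integralOp μ k ((NormedSpace.exp (c • integralOp μ k) ^ n) (k x)) y‖ ∂μ ≤
      8 * κ ^ 2 * (N + 1) * C ^ 2 *
        (1 + n * Real.exp (4 * (2 * κ * ((N + 1) * C)) * ‖c‖)) ^ N := by
  set T := integralOp μ k
  set A := 2 * κ * ((N + 1) * C) with hAdef
  have hA : 0 ≤ A := by positivity
  set B := Real.exp (4 * A * ‖c‖)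
  have hB : 0 < B := Real.exp_pos _
  let W : ℕ → C(X, ℂ) →L[ℂ] C(X, ℂ) := fun m => ContinuousLinearMap.mul ℂ C(X, ℂ) (distWeight L x m)
  have hW : ∀ m f, W m f = distWeight L x m * f := fun m f => rfl
  have hW0 : W 0 = 1 := by
    ext f y
    simp [hW, distWeight_apply]
  have hT : ∀ f, ‖toL2 μ (T f)‖ ≤ A * ‖toL2 μ f‖ :=
    norm_toL2_integralOp_le μ hκ hball hN hL hC hdecay
  have hmono : ∀ m f, ‖toL2 μ (W m f)‖ ≤ ‖toL2 μ (W (m + 1) f)‖ := by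
    intro m f
    refine norm_toL2_le_of_forall_le μ fun y => ?_
    rw [hW, hW, ContinuousMap.mul_apply, ContinuousMap.mul_apply, norm_mul, norm_mul,
      norm_distWeight hL, norm_distWeight hL]
    have h1 : 1 ≤ 1 + L * dist x y := by
      have : 0 ≤ L * dist x y := by positivity
      linarith
    gcongr
    omega
  have hcomm : ∀ m < N, ∀ f, ‖toL2 μ (W (m + 1) (T f) - T (W (m + 1) f))‖ ≤
      A * ‖toL2 μ (W m f)‖ := fun m hm f =>
    norm_toL2_commutator_le μ hκ hball hN hL hC hdecay x hm f
  have hsymm := inner_integralOp_left μ hk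
  set g := (NormedSpace.exp (c • T) ^ n) (k x)
  have h1 : ‖toL2 μ (W N g)‖ ≤ (1 + n * B) ^ N * ‖toL2 μ (W N (k x))‖ :=
    norm_weight_exp_pow_le hsymm hA hW0 hT hmono hcomm hc le_rfl n (k x)
  have h2 := norm_weight_apply_le hA hW0 hT hmono hcomm le_rfl g
  have h3 := integral_norm_le_weighted μ hκ hball hN hL x (T g)
  have h4 := norm_toL2_weight_kernel_le μ hκ hball hN hL hC hdecay x
  rw [← hW] at h3 h4
  rw [← pow_le_pow_iff_left₀ (integral_nonneg fun y => norm_nonneg _) (by positivity) two_ne_zero]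
  refine h3.trans ?_
  calc _ ≤ 2 * κ * L ^ (-α) * (2 * A * ((1 + n * B) ^ N * ‖toL2 μ (W N (k x))‖)) ^ 2 := by
        gcongr
        refine h2.trans ?_
        gcongr
    _ = 2 * κ * L ^ (-α) * (2 * A * (1 + n * B) ^ N) ^ 2 * ‖toL2 μ (W N (k x))‖ ^ 2 := by ring
    _ ≤ 2 * κ * L ^ (-α) * (2 * A * (1 + n * B) ^ N) ^ 2 * (2 * κ * C ^ 2 * L ^ α) := by gcongr
    _ = _ := by
        rw [Real.rpow_neg hL.le, hAdef]; field_simp; ring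

end Decay

end IntegralOperator

/-! ### A rapidly convergent Fourier expansion of `u⁻³`. -/

open scoped SchwartzMap FourierTransform in
/-- Rapidly decreasing coefficients of a trigonometric series that agrees with `u⁻³` on
`[exp (-1), 1]`. -/
lemma exists_fourier_coeff_inv_pow : ∃ c : ℤ → ℂ,
    (∀ (B : ℝ) (N : ℕ), Summable fun n : ℤ => ‖c n‖ * (1 + n.natAbs * B) ^ N) ∧
    ∀ u : ℝ, Real.exp (-1) ≤ u → u ≤ 1 →
      HasSum (fun n : ℤ => c n * Complex.exp (2 * Real.pi * Complex.I * n * u)) ((u : ℂ) ^ 3)⁻¹ := by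
  -- This bump is 1 on `[0.3, 1.1]`, which contains `[1/e, 1]`, and vanishes outside `[0.2, 1.2]`.
  -- Hence `b u * u⁻³` is smooth across 0, and its support has length 1, the period.
  let b : ContDiffBump (7 / 10 : ℝ) := ⟨4 / 10, 5 / 10, by norm_num, by norm_num⟩
  let θ : ℝ → ℂ := fun u => ((b u * (u ^ 3)⁻¹ : ℝ) : ℂ)
  have hsm : ContDiff ℝ ∞ θ := by
    refine Complex.ofRealCLM.contDiff.comp ?_
    rw [contDiff_iff_contDiffAt]
    intro u
    rcases eq_or_ne u 0 with rfl | hu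
    · refine (contDiffAt_const (c := (0 : ℝ))).congr_of_eventuallyEq ?_
      filter_upwards [Metric.ball_mem_nhds (0 : ℝ) (by norm_num : (0 : ℝ) < 1 / 10)] with v hv
      rw [b.zero_of_le_dist]
      · exact zero_mul _
      rw [Metric.mem_ball, Real.dist_eq, sub_zero, abs_lt] at hv
      rw [Real.dist_eq, abs_sub_comm, abs_of_nonneg (by linarith)]
      change (5 / 10 : ℝ) ≤ _
      linarith
    · exact b.contDiff.contDiffAt.mul ((contDiffAt_id.pow 3).inv (pow_ne_zero 3 hu))
  have hcs : HasCompactSupport θ := by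
    have h1 : HasCompactSupport fun u : ℝ => b u * (u ^ 3)⁻¹ := b.hasCompactSupport.mul_right
    exact h1.comp_left Complex.ofReal_zero
  let Θ : 𝓢(ℝ, ℂ) := hcs.toSchwartzMap hsm
  refine ⟨fun n => 𝓕 Θ n, fun B N => ?_, fun u hu0 hu1 => ?_⟩
  · have h1 : (fun x : ℝ => ‖𝓕 Θ x‖) =O[Filter.cocompact ℝ] fun x => |x| ^ (-(N + 2 : ℝ)) :=
      ((𝓕 Θ).isBigO_cocompact_rpow (-(N + 2 : ℝ))).norm_left
    have h2 : (fun n : ℤ => ‖𝓕 Θ n‖) =O[Filter.cofinite] fun n => |(n : ℝ)| ^ (-(N + 2 : ℝ)) :=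
      h1.comp_tendsto Int.tendsto_coe_cofinite
    have h3 : (fun n : ℤ => (1 + n.natAbs * B) ^ N) =O[Filter.cofinite]
        fun n => |(n : ℝ)| ^ (N : ℝ) := by
      refine Asymptotics.IsBigO.of_bound ((1 + |B|) ^ N) ?_
      filter_upwards [(Set.finite_singleton (0 : ℤ)).compl_mem_cofinite] with n hn
      have hn1 : 1 ≤ |(n : ℝ)| := by
        exact_mod_cast Int.one_le_abs hn
      have hnn : (n.natAbs : ℝ) = |(n : ℝ)| := by simp
      rw [Real.rpow_natCast, norm_pow, norm_pow, ← mul_pow, hnn, Real.norm_eq_abs,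
        Real.norm_eq_abs, abs_abs]
      refine pow_le_pow_left₀ (abs_nonneg _) ?_ _
      refine (abs_add_le _ _).trans ?_
      rw [abs_one, abs_mul, abs_abs, add_mul, one_mul, mul_comm |B|]
      linarith
    refine summable_of_isBigO (Real.summable_abs_int_rpow (b := 2) (by norm_num))
      ((h2.mul h3).congr' (.of_forall fun _ => rfl) ?_)
    filter_upwards [(Set.finite_singleton (0 : ℤ)).compl_mem_cofinite] with n hn
    have hn1 : 0 < |(n : ℝ)| := abs_pos.2 (by exact_mod_cast hn)
    rw [← Real.rpow_add hn1]
    congr 1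
    ring
  · have hexp : (0.3 : ℝ) ≤ Real.exp (-1) := by
      have := Real.exp_one_lt_d9
      rw [Real.exp_neg, le_inv_comm₀ (by norm_num) (Real.exp_pos _)]
      norm_num at this ⊢
      linarith
    have hsum : Summable fun n : ℤ => 𝓕 Θ n * fourier n (u : UnitAddCircle) := by
      have h1 : Summable fun n : ℤ => ‖𝓕 Θ n‖ :=
        summable_of_isBigO (Real.summable_abs_int_rpow (b := 2) (by norm_num))
          (((𝓕 Θ).isBigO_cocompact_rpow (-2)).norm_left.comp_tendsto Int.tendsto_coe_cofinite)
      refine Summable.of_norm_bounded h1 fun n => ?_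
      rw [norm_mul, fourier_apply, Circle.norm_coe, mul_one]
    have h2 := hsum.hasSum
    -- Poisson summation: the series is the periodization of `Θ`, and on `[1/e, 1]` all nonzero
    -- integer translates vanish.
    rw [← SchwartzMap.tsum_eq_tsum_fourier, tsum_eq_single (0 : ℤ)] at h2
    · have h3 : Θ (u + (0 : ℤ)) = ((u : ℂ) ^ 3)⁻¹ := by
        change (((b (u + (0 : ℤ)) * ((u + (0 : ℤ)) ^ 3)⁻¹ : ℝ)) : ℂ) = _
        rw [Int.cast_zero, add_zero, b.one_of_mem_closedBall]
        · push_cast; ring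
        · rw [Metric.mem_closedBall, Real.dist_eq, abs_le]
          change -(4 / 10 : ℝ) ≤ _ ∧ _ ≤ (4 / 10 : ℝ)
          norm_num at hexp
          constructor <;> linarith
      rw [h3] at h2
      refine h2.congr_fun fun n => ?_
      rw [fourier_coe_apply]
      simp
    · intro n hn
      change (((b (u + n) * ((u + n) ^ 3)⁻¹ : ℝ)) : ℂ) = 0
      rw [b.zero_of_le_dist, zero_mul, Complex.ofReal_zero]
      change (5 / 10 : ℝ) ≤ _
      norm_num at hexp
      rw [Real.dist_eq, le_abs]
      rcases lt_or_gt_of_ne hn with h | h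
      · right
        have : (n : ℝ) ≤ -1 := by exact_mod_cast (by omega : n ≤ -1)
        linarith
      · left
        have : (1 : ℝ) ≤ n := by exact_mod_cast h
        linarith

/-! ### The kernels of `T exp (2πinT) T` and their sum. -/

section Unitary

variable {X : Type*} [MetricSpace X] [CompactSpace X] [MeasurableSpace X] [BorelSpace X]
  (μ : Measure X) [IsFiniteMeasure μ]

lemma integral_tsum_le {F : ℤ → X → ℝ} (hF : ∀ n, Continuous (F n)) (hF0 : ∀ n y, 0 ≤ F n y)
    {b : ℤ → ℝ} (hFb : ∀ n, ∫ y, F n y ∂μ ≤ b n) (hb : Summable b) :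
    ∫ y, ∑' n, F n y ∂μ ≤ ∑' n, b n := by
  have h1 : Summable fun n => ∫ y, F n y ∂μ :=
    Summable.of_nonneg_of_le (fun n => integral_nonneg (hF0 n)) hFb hb
  rw [← integral_tsum_of_summable_integral_norm
    (fun n => (hF n).integrable_of_compactSpace μ)]
  · exact h1.tsum_le_tsum hFb hb
  · refine h1.congr fun n => ?_
    congr with y
    rw [Real.norm_of_nonneg (hF0 n y)]

/-- A series of integral operators is dominated by a kernel that satisfies Schur's condition. -/
lemma exists_dominating_kernel {E : ℤ → X → X → ℂ}
    (hE : ∀ n, Continuous fun z : X × X => E n z.1 z.2)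
    {S : ℝ} (hES : ∀ n x y, ‖E n x y‖ ≤ S) {b : ℤ → ℝ}
    (hrow : ∀ n x, ∫ y, ‖E n x y‖ ∂μ ≤ b n) (hcol : ∀ n y, ∫ x, ‖E n x y‖ ∂μ ≤ b n)
    {c : ℤ → ℂ} (hc1 : Summable fun n => ‖c n‖) (hc : Summable fun n => ‖c n‖ * b n) :
    ∃ G : X → X → ℝ, (Continuous fun z : X × X => G z.1 z.2) ∧ (∀ x y, 0 ≤ G x y) ∧
      (∀ x, ∫ y, G x y ∂μ ≤ ∑' n, ‖c n‖ * b n) ∧ (∀ y, ∫ x, G x y ∂μ ≤ ∑' n, ‖c n‖ * b n) ∧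
      ∀ (P : C(X, ℂ)) (x : X) (s : ℂ), HasSum (fun n => c n * ∫ y, P y * conj (E n x y) ∂μ) s →
        ‖s‖ ≤ ∫ y, G x y * ‖P y‖ ∂μ := by
  have hcont : ∀ n, Continuous fun z : X × X => ‖c n‖ * ‖E n z.1 z.2‖ :=
    fun n => continuous_const.mul (hE n).norm
  have hcx : ∀ n x, Continuous fun y => ‖c n‖ * ‖E n x y‖ :=
    fun n x => (hcont n).comp (Continuous.prodMk_right x)
  have hcy : ∀ n y, Continuous fun x => ‖c n‖ * ‖E n x y‖ :=
    fun n y => (hcont n).comp (Continuous.prodMk_left y)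
  have h0 : ∀ n x y, 0 ≤ ‖c n‖ * ‖E n x y‖ := fun n x y => by positivity
  have hbd : ∀ n (z : X × X), ‖‖c n‖ * ‖E n z.1 z.2‖‖ ≤ ‖c n‖ * S := by
    intro n z
    rw [norm_mul, norm_norm, norm_norm]
    exact mul_le_mul_of_nonneg_left (hES _ _ _) (norm_nonneg _)
  -- The uniform bound `S` only secures convergence and continuity; it may depend on `L`. The
  -- quantitative row and column bounds come from `b` alone.
  refine ⟨fun x y => ∑' n, ‖c n‖ * ‖E n x y‖, continuous_tsum hcont (hc1.mul_right S) hbd,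
    fun x y => tsum_nonneg fun n => h0 n x y, fun x => ?_, fun y => ?_, fun P x s hs => ?_⟩
  · refine integral_tsum_le μ (fun n => hcx n x) (fun n y => h0 n x y) (fun n => ?_) hc
    rw [integral_const_mul]
    exact mul_le_mul_of_nonneg_left (hrow n x) (norm_nonneg _)
  · refine integral_tsum_le μ (fun n => hcy n y) (fun n x => h0 n x y) (fun n => ?_) hc
    rw [integral_const_mul]
    exact mul_le_mul_of_nonneg_left (hcol n y) (norm_nonneg _)
  · have hI : ∀ n, Integrable (fun y => ‖c n‖ * ‖E n x y‖ * ‖P y‖) μ :=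
      fun n => ((hcx n x).mul P.continuous.norm).integrable_of_compactSpace μ
    have h1 : Summable fun n => ∫ y, ‖c n‖ * ‖E n x y‖ * ‖P y‖ ∂μ := by
      refine Summable.of_nonneg_of_le
        (fun n => integral_nonneg fun y => mul_nonneg (h0 n x y) (norm_nonneg _))
        (fun n => ?_) ((hc1.mul_right S).mul_right (∫ y, ‖P y‖ ∂μ))
      rw [← integral_const_mul]
      refine integral_mono (hI n)
        ((P.continuous.norm.integrable_of_compactSpace μ).const_mul _) fun y => ?_
      exact mul_le_mul_of_nonneg_right
        (mul_le_mul_of_nonneg_left (hES n x y) (norm_nonneg _)) (norm_nonneg _)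
    have h2 := hasSum_integral_of_summable_integral_norm hI (by
      refine h1.congr fun n => ?_
      congr with y
      rw [Real.norm_of_nonneg (mul_nonneg (h0 n x y) (norm_nonneg _))])
    simp_rw [tsum_mul_right] at h2
    refine hs.norm_le_of_bounded h2 fun n => ?_
    calc ‖c n * ∫ y, P y * conj (E n x y) ∂μ‖
        ≤ ‖c n‖ * ∫ y, ‖E n x y‖ * ‖P y‖ ∂μ := by
          rw [norm_mul]
          gcongr
          refine norm_integral_le_of_norm_le ?_ (.of_forall fun y => ?_)
          · exact (((hE n).comp (Continuous.prodMk_right x)).norm.mul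
              P.continuous.norm).integrable_of_compactSpace μ
          · rw [norm_mul, RCLike.norm_conj, mul_comm]
      _ = _ := by
          rw [← integral_const_mul]
          simp only [mul_assoc]

variable (k : C(X, C(X, ℂ)))

/-- The unitary group `exp (2 π i n T)` generated by the integral operator `T` with kernel `k`. -/
noncomputable def unitaryOp (n : ℤ) : C(X, ℂ) →L[ℂ] C(X, ℂ) :=
  NormedSpace.exp ((2 * Real.pi * Complex.I * n) • integralOp μ k)

/-- The sign of `n` goes into `c`, whose modulus stays `2π`. The factor `exp (4 A ‖c‖)` in the
weighted bounds is then the same for all `n`, and `n` enters only through the exponent of the power.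
-/
lemma unitaryOp_eq_pow (n : ℤ) : ∃ c : ℂ, conj c = -c ∧ ‖c‖ = 2 * Real.pi ∧
    unitaryOp μ k n = NormedSpace.exp (c • integralOp μ k) ^ n.natAbs := by
  have hn : ‖(2 * Real.pi * Complex.I : ℂ)‖ = 2 * Real.pi := by
    simp [abs_of_pos Real.pi_pos]
  let _ : NormedAlgebra ℚ (C(X, ℂ) →L[ℂ] C(X, ℂ)) := NormedAlgebra.restrictScalars ℚ ℂ _
  rcases le_total 0 n with h | h
  · refine ⟨2 * Real.pi * Complex.I, by simp [Complex.conj_ofNat], hn, ?_⟩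
    rw [unitaryOp, ← NormedSpace.exp_nsmul n.natAbs (_ • integralOp μ k), ← Nat.cast_smul_eq_nsmul ℂ, smul_smul]
    have : (n : ℂ) = (n.natAbs : ℂ) := by
      conv_lhs => rw [← Int.natAbs_of_nonneg h]
      exact Int.cast_natCast _
    rw [this, mul_comm]
  · refine ⟨-(2 * Real.pi * Complex.I), by simp [Complex.conj_ofNat], by rw [norm_neg, hn], ?_⟩
    rw [unitaryOp, ← NormedSpace.exp_nsmul n.natAbs (_ • integralOp μ k), ← Nat.cast_smul_eq_nsmul ℂ, smul_smul]
    have : (n : ℂ) = -(n.natAbs : ℂ) := by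
      conv_lhs => rw [show n = -(n.natAbs : ℤ) by omega]
      rw [Int.cast_neg, Int.cast_natCast]
    rw [this]
    congr 2
    ring

/-- The kernel of `T exp (2 π i n T) T`. -/
noncomputable def unitaryKernel (n : ℤ) (x y : X) : ℂ :=
  integralOp μ k (unitaryOp μ k n (k x)) y

lemma continuous_unitaryKernel (n : ℤ) :
    Continuous fun z : X × X => unitaryKernel μ k n z.1 z.2 :=
  ContinuousEval.continuous_eval.comp
    ((((integralOp μ k).comp (unitaryOp μ k n)).continuous.comp
      (k.continuous.comp continuous_fst)).prodMk continuous_snd)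

variable {k}

lemma inner_unitaryOp_left (hk : ∀ x y, k x y = conj (k y x)) (n : ℤ) (f g : C(X, ℂ)) :
    inner ℂ (toL2 μ (unitaryOp μ k n f)) (toL2 μ g) =
      inner ℂ (toL2 μ f) (toL2 μ (unitaryOp μ k (-n) g)) := by
  rw [unitaryOp, inner_exp_smul_left (inner_integralOp_left μ hk), unitaryOp]
  congr 5
  simp [Complex.conj_ofNat]

lemma norm_unitaryOp (hk : ∀ x y, k x y = conj (k y x)) (n : ℤ) (f : C(X, ℂ)) :
    ‖toL2 μ (unitaryOp μ k n f)‖ = ‖toL2 μ f‖ :=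
  norm_exp_smul_apply (inner_integralOp_left μ hk) (by simp [Complex.conj_ofNat]) f

/-- Taking adjoints reverses the sign of `n`; this turns row bounds into column bounds. -/
lemma unitaryKernel_symm (hk : ∀ x y, k x y = conj (k y x)) (n : ℤ) (x y : X) :
    unitaryKernel μ k n x y = conj (unitaryKernel μ k (-n) y x) := by
  rw [unitaryKernel, unitaryKernel, integralOp_eq_inner, integralOp_eq_inner, inner_conj_symm,
    inner_unitaryOp_left μ hk, neg_neg]

lemma norm_unitaryKernel_le (hk : ∀ x y, k x y = conj (k y x)) (n : ℤ) (x y : X) :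
    ‖unitaryKernel μ k n x y‖ ≤ (‖toL2 μ‖ * ‖k‖) ^ 2 := by
  have h : ∀ x, ‖toL2 μ (k x)‖ ≤ ‖toL2 μ‖ * ‖k‖ := fun x =>
    ((toL2 μ).le_opNorm _).trans (by gcongr; exact k.norm_coe_le_norm x)
  rw [unitaryKernel, integralOp_eq_inner, sq]
  refine (norm_inner_le_norm _ _).trans ?_
  rw [norm_unitaryOp μ hk]
  exact mul_le_mul (h y) (h x) (norm_nonneg _) (by positivity)

lemma integralOp_unitaryOp_integralOp (hk : ∀ x y, k x y = conj (k y x)) (n : ℤ)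
    (P : C(X, ℂ)) (x : X) :
    integralOp μ k (unitaryOp μ k n (integralOp μ k P)) x =
      ∫ y, P y * conj (unitaryKernel μ k (-n) x y) ∂μ := by
  have h : inner ℂ (toL2 μ (k x)) (toL2 μ (unitaryOp μ k n (integralOp μ k P))) =
      inner ℂ (toL2 μ (integralOp μ k (unitaryOp μ k (-n) (k x)))) (toL2 μ P) := by
    rw [inner_integralOp_left μ hk, inner_unitaryOp_left μ hk, neg_neg]
  rw [integralOp_eq_inner, h, inner_toL2]
  rfl

lemma integral_norm_unitaryKernel_le (hk : ∀ x y, k x y = conj (k y x)) {α κ C L : ℝ} {N : ℕ}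
    (hκ : 0 < κ)
    (hball : ∀ (x : X) (r : ℝ), 0 < r → μ.real (Metric.closedBall x r) ≤ κ * r ^ α)
    (hN : α + 2 ≤ N) (hL : 0 < L) (hC : 0 < C)
    (hdecay : ∀ x y, ‖k x y‖ ≤ C * L ^ α * ((1 + L * dist x y) ^ (2 * N))⁻¹) (n : ℤ) (x : X) :
    ∫ y, ‖unitaryKernel μ k n x y‖ ∂μ ≤ 8 * κ ^ 2 * (N + 1) * C ^ 2 *
      (1 + n.natAbs * Real.exp (4 * (2 * κ * ((N + 1) * C)) * (2 * Real.pi))) ^ N := by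
  obtain ⟨c, hc, hcn, h⟩ := unitaryOp_eq_pow μ k n
  have := integral_norm_integralOp_exp_pow_le μ hk hκ hball hN hL hC hdecay hc n.natAbs x
  rw [hcn] at this
  simpa only [unitaryKernel, h] using this

end Unitary

/-! ### Gaussian bounds at time `L⁻²` as polynomial decay in `L ρ`. -/

/-- Combine `(1 + s)² ≤ 2 (1 + s²)` with `z^N / N! ≤ exp z` at `z = κ (1 + s²)`. -/
lemma exp_neg_mul_sq_le {κ s : ℝ} (hκ : 0 < κ) (hs : 0 ≤ s) (N : ℕ) :
    Real.exp (-κ * s ^ 2) ≤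
      (2 / κ) ^ N * N.factorial * Real.exp κ * ((1 + s) ^ (2 * N))⁻¹ := by
  have h1 : (κ * (1 + s ^ 2)) ^ N / N.factorial ≤ Real.exp (κ * (1 + s ^ 2)) :=
    Real.pow_div_factorial_le_exp _ (by positivity) N
  have h2 : (1 + s) ^ (2 * N) ≤ (2 / κ) ^ N * (κ * (1 + s ^ 2)) ^ N := by
    rw [pow_mul, ← mul_pow]
    gcongr
    field_simp
    nlinarith [sq_nonneg (1 - s)]
  rw [← div_eq_mul_inv, le_div_iff₀ (by positivity)]
  calc Real.exp (-κ * s ^ 2) * (1 + s) ^ (2 * N)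
      ≤ Real.exp (-κ * s ^ 2) * ((2 / κ) ^ N *
        (N.factorial * Real.exp (κ * (1 + s ^ 2)))) := by
        gcongr
        refine h2.trans ?_
        gcongr
        rwa [div_le_iff₀' (by positivity)] at h1
    _ = (2 / κ) ^ N * N.factorial *
        (Real.exp (-κ * s ^ 2) * Real.exp (κ * (1 + s ^ 2))) := by ring
    _ = _ := by rw [← Real.exp_add]; congr 2; ring

lemma rpow_inv_sq {L : ℝ} (hL : 0 < L) (α : ℝ) : ((L ^ 2)⁻¹ : ℝ) ^ (-(α / 2)) = L ^ α := by
  rw [Real.inv_rpow (by positivity), Real.rpow_neg (by positivity), inv_inv, ← Real.rpow_natCast,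
    ← Real.rpow_mul hL.le]
  congr 1
  push_cast
  ring

lemma rpow_inv_sq' {L : ℝ} (hL : 0 < L) (α : ℝ) :
    ((L ^ 2)⁻¹ : ℝ) ^ (-(α / 2) - 1 / 2) = L ^ α * L := by
  rw [show -(α / 2) - 1 / 2 = -((α + 1) / 2) by ring, rpow_inv_sq hL, Real.rpow_add_one hL.ne']

lemma exp_div_inv_sq {κ L : ℝ} (d : ℝ) :
    Real.exp (-κ * d ^ 2 / (L ^ 2)⁻¹) = Real.exp (-κ * (L * d) ^ 2) := by
  rw [div_inv_eq_mul, mul_pow]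
  congr 1
  ring

/-! ### The heat kernel: convergence, eigenfunctions, decay and differences. -/

section HeatKernelSeries

variable {M : Type*} [TopologicalSpace M] {φ : ℕ → C(M, ℂ)} {ℓ : ℕ → ℝ}

lemma norm_heatKernel_term_le (t : ℝ) (x y : M) (k : ℕ) :
    ‖(Real.exp (-(ℓ k) ^ 2 * t) : ℂ) * φ k x * conj (φ k y)‖ ≤
      (Real.exp (-(ℓ k) ^ 2 * t) * ‖φ k x‖ ^ 2 + Real.exp (-(ℓ k) ^ 2 * t) * ‖φ k y‖ ^ 2) / 2 := by
  rw [norm_mul, norm_mul, RCLike.norm_conj, Complex.norm_real,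
    Real.norm_of_nonneg (Real.exp_pos _).le]
  nlinarith [mul_nonneg (Real.exp_pos (-(ℓ k) ^ 2 * t)).le (sq_nonneg (‖φ k x‖ - ‖φ k y‖))]

lemma heatKernel_symm (t : ℝ) (x y : M) :
    heatKernel φ ℓ t x y = conj (heatKernel φ ℓ t y x) := by
  rw [heatKernel, heatKernel, Complex.conj_tsum]
  congr with k
  rw [map_mul, map_mul, Complex.conj_ofReal, Complex.conj_conj]
  ring

end HeatKernelSeries

section HeatKernel

variable {q : ℕ} {M : Type*} [MetricSpace M]
    [ChartedSpace (EuclideanSpace ℝ (Fin q)) M]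
    [Bundle.RiemannianBundle (fun x : M => TangentSpace (𝓡 q) x)]
    [MeasurableSpace M] {μ : Measure M} {α κ₂ κ₃ κ₄ : ℝ} {φ : ℕ → C(M, ℂ)} {ℓ : ℕ → ℝ}

namespace IsDiffusionSystem

lemma one_le_ell (h : IsDiffusionSystem (q := q) μ α κ₂ κ₃ κ₄ φ ℓ) (j : ℕ) : 1 ≤ ℓ j :=
  h.ell_zero ▸ h.ell_mono (Nat.zero_le j)

lemma summable_diag (h : IsDiffusionSystem (q := q) μ α κ₂ κ₃ κ₄ φ ℓ) (hκ₄ : 0 < κ₄) {t : ℝ}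
    (ht : 0 < t) (ht1 : t ≤ 1) (x : M) :
    Summable (fun k => Real.exp (-(ℓ k) ^ 2 * t) * ‖φ k x‖ ^ 2) ∧
      ∑' k, Real.exp (-(ℓ k) ^ 2 * t) * ‖φ k x‖ ^ 2 ≤ κ₂ * t ^ (-(α / 2)) := by
  have h1 : heatKernel φ ℓ t x x = ((∑' k, Real.exp (-(ℓ k) ^ 2 * t) * ‖φ k x‖ ^ 2 : ℝ) : ℂ) := by
    rw [heatKernel, Complex.ofReal_tsum]
    congr with k
    rw [mul_assoc, Complex.mul_conj, Complex.normSq_eq_norm_sq]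
    push_cast
    ring
  constructor
  · by_contra hns
    have h2 := h.diagonal_lower t ht ht1 x
    rw [h1, tsum_eq_zero_of_not_summable hns, Complex.ofReal_re] at h2
    have : 0 < κ₄ * t ^ (-(α / 2)) := by positivity
    linarith
  · have h2 := h.gaussian_upper t ht ht1 x x
    rw [h1, Complex.norm_real] at h2
    simpa using (le_abs_self _).trans h2

lemma summable_norm_term (h : IsDiffusionSystem (q := q) μ α κ₂ κ₃ κ₄ φ ℓ) (hκ₄ : 0 < κ₄) {t : ℝ}
    (ht : 0 < t) (ht1 : t ≤ 1) (x y : M) :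
    Summable (fun k => ‖(Real.exp (-(ℓ k) ^ 2 * t) : ℂ) * φ k x * conj (φ k y)‖) ∧
      ∑' k, ‖(Real.exp (-(ℓ k) ^ 2 * t) : ℂ) * φ k x * conj (φ k y)‖ ≤ κ₂ * t ^ (-(α / 2)) := by
  obtain ⟨hx, hx'⟩ := h.summable_diag hκ₄ ht ht1 x
  obtain ⟨hy, hy'⟩ := h.summable_diag hκ₄ ht ht1 y
  have hs := (hx.add hy).div_const 2
  have hs1 : Summable (fun k => ‖(Real.exp (-(ℓ k) ^ 2 * t) : ℂ) * φ k x * conj (φ k y)‖) :=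
    Summable.of_nonneg_of_le (fun _ => norm_nonneg _) (norm_heatKernel_term_le t x y) hs
  refine ⟨hs1, (hs1.tsum_le_tsum (norm_heatKernel_term_le t x y) hs).trans ?_⟩
  rw [tsum_div_const, hx.tsum_add hy]
  linarith

/-- The `φⱼ` are eigenfunctions of the heat operator. -/
lemma integral_mul_heatKernel [CompactSpace M] [BorelSpace M] [IsProbabilityMeasure μ]
    (h : IsDiffusionSystem (q := q) μ α κ₂ κ₃ κ₄ φ ℓ) (hκ₄ : 0 < κ₄)
    {t : ℝ} (ht : 0 < t) (ht1 : t ≤ 1) (x : M) (j : ℕ) :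
    ∫ y, φ j y * heatKernel φ ℓ t x y ∂μ = (Real.exp (-(ℓ j) ^ 2 * t) : ℂ) * φ j x := by
  set F : ℕ → M → ℂ := fun k y =>
    φ j y * ((Real.exp (-(ℓ k) ^ 2 * t) : ℂ) * φ k x * conj (φ k y)) with hF
  have hFi : ∀ k, Integrable (F k) μ := fun k =>
    ((φ j).continuous.mul (continuous_const.mul
      (Complex.continuous_conj.comp (φ k).continuous))).integrable_of_compactSpace μ
  have hsum : Summable fun k => ∫ y, ‖F k y‖ ∂μ := by
    refine summable_of_sum_le (c := ‖φ j‖ * (κ₂ * t ^ (-(α / 2))))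
      (fun k => integral_nonneg fun y => norm_nonneg _) fun s => ?_
    rw [← integral_finsetSum _ fun k _ => (hFi k).norm]
    calc ∫ y, ∑ k ∈ s, ‖F k y‖ ∂μ ≤ ∫ _, ‖φ j‖ * (κ₂ * t ^ (-(α / 2))) ∂μ := by
          refine integral_mono (integrable_finsetSum _ fun k _ => (hFi k).norm)
            (integrable_const _) fun y => ?_
          obtain ⟨h1, h2⟩ := h.summable_norm_term hκ₄ ht ht1 x y
          simp only [hF, norm_mul (φ j y), ← Finset.mul_sum]
          exact mul_le_mul ((φ j).norm_coe_le_norm y)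
            ((h1.sum_le_tsum s fun _ _ => norm_nonneg _).trans h2)
            (Finset.sum_nonneg fun _ _ => norm_nonneg _) (norm_nonneg _)
      _ = _ := by simp
  have h1 := hasSum_integral_of_summable_integral_norm hFi hsum
  have h2 : ∀ k, ∫ y, F k y ∂μ =
      if k = j then (Real.exp (-(ℓ j) ^ 2 * t) : ℂ) * φ j x else 0 := by
    intro k
    have : ∀ y, F k y = (Real.exp (-(ℓ k) ^ 2 * t) : ℂ) * φ k x * (φ j y * conj (φ k y)) :=
      fun y => by rw [hF]; ring
    simp_rw [this]
    rw [integral_const_mul, h.orthonormal]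
    by_cases hkj : k = j
    · rw [if_pos hkj, if_pos hkj.symm, hkj, mul_one]
    · rw [if_neg hkj, if_neg (Ne.symm hkj), mul_zero]
  simp_rw [h2] at h1
  have h3 := h1.unique (hasSum_ite_eq j _)
  rw [← h3]
  congr with y
  rw [hF, heatKernel, tsum_mul_left]

/-- A crude Lipschitz bound that discards the Gaussian factor; it serves the continuity of the
kernel, not the estimates. -/
lemma norm_heatKernel_sub_le_mul_dist [IsRiemannianManifold (𝓡 q) M]
    (h : IsDiffusionSystem (q := q) μ α κ₂ κ₃ κ₄ φ ℓ)
    (hκ₂ : 0 < κ₂) (hκ₃ : 0 < κ₃) {t : ℝ} (ht : 0 < t) (ht1 : t ≤ 1) (x y z : M) :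
    ‖heatKernel φ ℓ t x z - heatKernel φ ℓ t x y‖ ≤
      κ₂ * t ^ (-(α / 2) - 1 / 2) * dist y z := by
  set D := κ₂ * t ^ (-(α / 2) - 1 / 2) with hD
  have hD0 : 0 < D := by positivity
  refine le_of_forall_pos_le_add fun ε hε => ?_
  have h1 : dist y z < dist y z + ε / D := lt_add_of_pos_right _ (by positivity)
  refine (norm_sub_le_of_tangentDeriv_le (h.differentiable t ht ht1 x) h1 hD0.le
    fun u _ v => ?_).trans_eq ?_
  · refine (h.gaussian_gradient t ht ht1 x u v).trans ?_
    gcongr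
    refine mul_le_of_le_one_right hD0.le (Real.exp_le_one_iff.2 ?_)
    have : 0 ≤ κ₃ * dist x u ^ 2 := by positivity
    rw [neg_mul]
    exact div_nonpos_of_nonpos_of_nonneg (by linarith) ht.le
  · field_simp

/-- The heat kernel as a continuous family of continuous functions. -/
lemma exists_kernel [CompactSpace M] [IsRiemannianManifold (𝓡 q) M]
    (h : IsDiffusionSystem (q := q) μ α κ₂ κ₃ κ₄ φ ℓ)
    (hκ₂ : 0 < κ₂) (hκ₃ : 0 < κ₃) {t : ℝ} (ht : 0 < t) (ht1 : t ≤ 1) :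
    ∃ k : C(M, C(M, ℂ)), ∀ x y, k x y = heatKernel φ ℓ t y x := by
  have hc : ∀ x, Continuous fun y => heatKernel φ ℓ t y x := fun x => by
    simp_rw [fun y => heatKernel_symm (φ := φ) (ℓ := ℓ) t y x]
    exact Complex.continuous_conj.comp (h.differentiable t ht ht1 x).continuous
  have hD : 0 ≤ κ₂ * t ^ (-(α / 2) - 1 / 2) := by positivity
  -- The outer variable of `k` is the second one of the heat kernel, in which the gradient bound
  -- gives Lipschitz dependence uniformly in the other variable.
  refine ⟨⟨fun x => ⟨fun y => heatKernel φ ℓ t y x, hc x⟩, ?_⟩, fun x y => rfl⟩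
  refine (LipschitzWith.of_dist_le_mul (K := ⟨_, hD⟩) fun x x' => ?_).continuous
  refine (ContinuousMap.dist_le (mul_nonneg hD dist_nonneg)).2 fun y => ?_
  rw [dist_comm x x', dist_eq_norm]
  exact h.norm_heatKernel_sub_le_mul_dist hκ₂ hκ₃ ht ht1 y x' x

lemma norm_heatKernel_le (h : IsDiffusionSystem (q := q) μ α κ₂ κ₃ κ₄ φ ℓ)
    (hκ₂ : 0 < κ₂) (hκ₃ : 0 < κ₃) {L : ℝ} (hL : 1 ≤ L) (N : ℕ) (x y : M) :
    ‖heatKernel φ ℓ (L ^ 2)⁻¹ x y‖ ≤ κ₂ * ((2 / κ₃) ^ N * N.factorial * Real.exp κ₃) * L ^ α *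
      ((1 + L * dist x y) ^ (2 * N))⁻¹ := by
  have hL0 : 0 < L := by linarith
  refine (h.gaussian_upper _ (by positivity) (inv_le_one_of_one_le₀ (one_le_pow₀ hL)) x y).trans ?_
  rw [rpow_inv_sq hL0, exp_div_inv_sq]
  calc _ ≤ κ₂ * L ^ α * ((2 / κ₃) ^ N * N.factorial * Real.exp κ₃ *
        ((1 + L * dist x y) ^ (2 * N))⁻¹) := by
        gcongr; exact exp_neg_mul_sq_le hκ₃ (by positivity) N
    _ = _ := by ring

/-- The mean value inequality needs a radius strictly above `ρ(x, z)`, hence `2 r`. Every `w` in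
that ball has `1 + L ρ(x, w) ≤ 4`, so the decay can be recentred from `w` to `x` at the cost of
`4^(2N)`. -/
lemma norm_heatKernel_sub_le [IsRiemannianManifold (𝓡 q) M]
    (h : IsDiffusionSystem (q := q) μ α κ₂ κ₃ κ₄ φ ℓ)
    (hκ₂ : 0 < κ₂) (hκ₃ : 0 < κ₃) {L : ℝ} (hL : 1 ≤ L) (N : ℕ) {r : ℝ} (hr : 0 < r)
    (hLr : L * r ≤ 1) {u x z : M} (hxz : dist x z ≤ r) :
    ‖heatKernel φ ℓ (L ^ 2)⁻¹ u z - heatKernel φ ℓ (L ^ 2)⁻¹ u x‖ ≤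
      2 * 4 ^ (2 * N) * κ₂ * ((2 / κ₃) ^ N * N.factorial * Real.exp κ₃) * (L * r) * L ^ α *
        ((1 + L * dist x u) ^ (2 * N))⁻¹ := by
  have hL0 : 0 < L := by linarith
  have ht1 : (L ^ 2)⁻¹ ≤ 1 := inv_le_one_of_one_le₀ (one_le_pow₀ hL)
  set c := (2 / κ₃) ^ N * N.factorial * Real.exp κ₃ with hc
  have hc0 : 0 < c := by positivity
  clear_value c
  refine (norm_sub_le_of_tangentDeriv_le (r := 2 * r)
    (C := κ₂ * (L ^ α * L) * (c * 4 ^ (2 * N) * ((1 + L * dist x u) ^ (2 * N))⁻¹))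
    (h.differentiable _ (by positivity) ht1 u) (by linarith) (by positivity)
    fun w hw v => ?_).trans_eq ?_
  · refine (h.gaussian_gradient _ (by positivity) ht1 u w v).trans ?_
    rw [rpow_inv_sq' hL0, exp_div_inv_sq]
    gcongr
    refine (exp_neg_mul_sq_le hκ₃ (by positivity) N).trans ?_
    rw [← hc, mul_assoc]
    gcongr
    rw [← div_eq_mul_inv, le_div_iff₀ (by positivity), inv_mul_le_iff₀ (by positivity),
      ← mul_pow]
    refine pow_le_pow_left₀ (by positivity) ?_ _
    have h2 : 1 + L * dist x w ≤ 4 := by nlinarith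
    calc 1 + L * dist x u ≤ (1 + L * dist x w) * (1 + L * dist w u) :=
          one_add_mul_dist_le hL0 x u w
      _ ≤ 4 * (1 + L * dist w u) := by gcongr
      _ = _ := by rw [dist_comm w u]; ring
  · ring

end IsDiffusionSystem

end HeatKernel

/-! ### The oscillation estimate. -/

section Local

variable {q : ℕ} {M : Type*} [MetricSpace M] [CompactSpace M]
    [ChartedSpace (EuclideanSpace ℝ (Fin q)) M]
    [Bundle.RiemannianBundle (fun x : M => TangentSpace (𝓡 q) x)]
    [MeasurableSpace M] [BorelSpace M] {μ : Measure M} [IsProbabilityMeasure μ]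
    {α κ₁ κ₂ κ₃ κ₄ : ℝ}

/-- A diffusion polynomial is the image, under the heat operator, of the sum of a rapidly
convergent series in the unitary group generated by that operator. -/
lemma IsDiffusionSystem.exists_integralOp_eq {φ : ℕ → C(M, ℂ)} {ℓ : ℕ → ℝ}
    (h : IsDiffusionSystem (q := q) μ α κ₂ κ₃ κ₄ φ ℓ) (hκ₄ : 0 < κ₄) {L : ℝ} (hL : 1 ≤ L)
    {k : C(M, C(M, ℂ))} (hk : ∀ x y, k x y = heatKernel φ ℓ (L ^ 2)⁻¹ y x) {c : ℤ → ℂ}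
    (hc : ∀ u : ℝ, Real.exp (-1) ≤ u → u ≤ 1 →
      HasSum (fun n : ℤ => c n * Complex.exp (2 * Real.pi * Complex.I * n * u)) ((u : ℂ) ^ 3)⁻¹)
    {P : C(M, ℂ)} (hP : P ∈ diffusionPoly φ ℓ L) :
    ∃ Q : C(M, ℂ), integralOp μ k Q = P ∧ ∀ x, HasSum (fun n : ℤ =>
      c n * integralOp μ k (unitaryOp μ k n (integralOp μ k P)) x) (Q x) := by
  induction hP using Submodule.span_induction with
  | mem P hP =>
    obtain ⟨j, hj, rfl⟩ := hP
    set u := Real.exp (-(ℓ j) ^ 2 * (L ^ 2)⁻¹) with hu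
    have hu0 : (u : ℂ) ≠ 0 := by exact_mod_cast (Real.exp_pos _).ne'
    have hT : integralOp μ k (φ j) = (u : ℂ) • φ j := by
      ext x
      rw [integralOp_apply, ContinuousMap.smul_apply, smul_eq_mul, hu,
        ← h.integral_mul_heatKernel hκ₄ (by positivity) (inv_le_one_of_one_le₀ (one_le_pow₀ hL))]
      congr with y
      rw [hk, ← heatKernel_symm]
    have hu1 : Real.exp (-1) ≤ u := by
      refine Real.exp_le_exp.2 ?_
      have h1 : ℓ j ^ 2 ≤ L ^ 2 :=
        pow_le_pow_left₀ (by linarith [h.one_le_ell j]) hj 2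
      have h2 : ℓ j ^ 2 * (L ^ 2)⁻¹ ≤ 1 := by
        rw [← div_eq_mul_inv]; exact div_le_one_of_le₀ h1 (by positivity)
      linarith
    have hu2 : u ≤ 1 := by
      refine Real.exp_le_one_iff.2 ?_
      have : 0 ≤ ℓ j ^ 2 * (L ^ 2)⁻¹ := by positivity
      linarith
    refine ⟨(u : ℂ)⁻¹ • φ j, ?_, fun x => ?_⟩
    · rw [map_smul, hT, smul_smul, inv_mul_cancel₀ hu0, one_smul]
    · have h1 := (hc u hu1 hu2).mul_right ((u : ℂ) ^ 2 * φ j x)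
      have h2 : ((u : ℂ) ^ 3)⁻¹ * ((u : ℂ) ^ 2 * φ j x) = ((u : ℂ)⁻¹ • φ j) x := by
        rw [ContinuousMap.smul_apply, smul_eq_mul]
        field_simp
      rw [h2] at h1
      refine h1.congr_fun fun n => ?_
      rw [hT, map_smul, unitaryOp, exp_smul_apply_of_eigenvector hT, map_smul, map_smul, hT]
      simp only [ContinuousMap.smul_apply, smul_eq_mul]
      ring
  | zero => exact ⟨0, by simp, fun x => by simp⟩
  | add P P' _ _ ih ih' =>
    obtain ⟨Q, hQ, hs⟩ := ih
    obtain ⟨Q', hQ', hs'⟩ := ih'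
    refine ⟨Q + Q', by rw [map_add, hQ, hQ'], fun x => ?_⟩
    refine ((hs x).add (hs' x)).congr_fun fun n => ?_
    simp only [map_add, ContinuousMap.add_apply]
    ring
  | smul a P _ ih =>
    obtain ⟨Q, hQ, hs⟩ := ih
    refine ⟨a • Q, by rw [map_smul, hQ], fun x => ?_⟩
    refine ((hs x).mul_left a).congr_fun fun n => ?_
    simp only [map_smul, ContinuousMap.smul_apply, smul_eq_mul]
    ring

/-- Oscillation estimate: the oscillation of a diffusion polynomial of degree at most `L` on balls
of radius `r` is dominated by a function that is small in every `Lᵖ`. -/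
lemma exists_oscillation_bound [IsRiemannianManifold (𝓡 q) M] (hκ₁ : 0 < κ₁) (hκ₂ : 0 < κ₂) (hκ₃ : 0 < κ₃) (hκ₄ : 0 < κ₄)
    (hball : ∀ (x : M) (r : ℝ), 0 < r → μ.real (Metric.closedBall x r) ≤ κ₁ * r ^ α) :
    ∃ A : ℝ, 0 < A ∧ ∀ (φ : ℕ → C(M, ℂ)) (ℓ : ℕ → ℝ),
      IsDiffusionSystem (q := q) μ α κ₂ κ₃ κ₄ φ ℓ →
      ∀ L r : ℝ, 1 ≤ L → 0 < r → L * r ≤ 1 → ∀ P ∈ diffusionPoly φ ℓ L,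
      ∃ f : M → ℝ, Continuous f ∧ (∀ x, 0 ≤ f x) ∧
        (∀ x z, dist x z ≤ r → ‖P x - P z‖ ≤ f x) ∧
        (∀ p : ℝ, 1 ≤ p → ∫ x, f x ^ p ∂μ ≤ (A * (L * r)) ^ p * ∫ x, ‖P x‖ ^ p ∂μ) ∧
        ∀ x, f x ≤ A * (L * r) * ‖P‖ := by
  set N := ⌈α⌉₊ + 2 with hNdef
  have hN : α + 2 ≤ N := by
    rw [hNdef]; push_cast; linarith [Nat.le_ceil α]
  set C := κ₂ * ((2 / κ₃) ^ N * N.factorial * Real.exp κ₃) with hC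
  have hC0 : 0 < C := by positivity
  set B := Real.exp (4 * (2 * κ₁ * ((N + 1) * C)) * (2 * Real.pi)) with hB
  have hB0 : 0 < B := Real.exp_pos _
  obtain ⟨c, hcs, hc⟩ := exists_fourier_coeff_inv_pow
  set b : ℤ → ℝ := fun n => 8 * κ₁ ^ 2 * (N + 1) * C ^ 2 * (1 + n.natAbs * B) ^ N with hb
  have hcb : Summable fun n => ‖c n‖ * b n := by
    refine ((hcs B N).mul_left (8 * κ₁ ^ 2 * (N + 1) * C ^ 2)).congr fun n => ?_
    rw [hb]; ring
  have hc1 : Summable fun n => ‖c n‖ := by simpa using hcs 0 0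
  set S := ∑' n, ‖c n‖ * b n with hS
  have hS0 : 0 ≤ S := tsum_nonneg fun n => by positivity
  -- The product of the Schur constants of `D` (without the factor `L r`) and of `G`; `S + 1`
  -- replaces `S` because Schur's test needs a positive constant. All of this is fixed before `φ`,
  -- `ℓ` and `L`.
  refine ⟨2 * κ₁ * (2 * 4 ^ (2 * N) * C) * (S + 1), by positivity,
    fun φ ℓ h L r hL hr hLr P hP => ?_⟩
  have hL0 : 0 < L := by linarith
  obtain ⟨k, hk⟩ := h.exists_kernel hκ₂ hκ₃ (t := (L ^ 2)⁻¹) (by positivity)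
    (inv_le_one_of_one_le₀ (one_le_pow₀ hL))
  have hsymm : ∀ x y, k x y = conj (k y x) := fun x y => by
    rw [hk, hk, ← heatKernel_symm]
  have hdecay : ∀ x y, ‖k x y‖ ≤ C * L ^ α * ((1 + L * dist x y) ^ (2 * N))⁻¹ := fun x y => by
    rw [hk, dist_comm]
    exact h.norm_heatKernel_le hκ₂ hκ₃ hL N y x
  obtain ⟨Q, hQ, hQs⟩ := h.exists_integralOp_eq hκ₄ hL hk hc hP
  have hrow : ∀ n x, ∫ y, ‖unitaryKernel μ k n x y‖ ∂μ ≤ b n := fun n x =>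
    integral_norm_unitaryKernel_le μ hsymm hκ₁ hball hN hL0 hC0 hdecay n x
  obtain ⟨G, hGc, hG0, hGrow, hGcol, hG⟩ := exists_dominating_kernel μ
    (E := fun n => unitaryKernel μ k (-n)) (fun n => continuous_unitaryKernel μ k (-n))
    (fun n x y => norm_unitaryKernel_le μ hsymm (-n) x y) (b := b)
    (fun n x => by simpa [hb] using hrow (-n) x)
    (fun n y => by
      have : ∀ x, ‖unitaryKernel μ k (-n) x y‖ = ‖unitaryKernel μ k n y x‖ := fun x => by
        rw [unitaryKernel_symm μ hsymm, neg_neg, RCLike.norm_conj]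
      simp_rw [this]
      exact hrow n y) hc1 hcb
  have hQG : ∀ x, ‖Q x‖ ≤ ∫ y, G x y * ‖P y‖ ∂μ := fun x => by
    refine hG P x (Q x) ((hQs x).congr_fun fun n => ?_)
    rw [integralOp_unitaryOp_integralOp μ hsymm]
  set a := 2 * 4 ^ (2 * N) * C * (L * r) with ha
  have ha0 : 0 < a := by positivity
  set D : M → M → ℝ := fun x u => a * L ^ α * ((1 + L * dist x u) ^ N)⁻¹ with hD
  have hDc : Continuous fun z : M × M => D z.1 z.2 := continuous_decay hL0 a N
  have hD0 : ∀ x u, 0 ≤ D x u := fun x u => by positivity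
  have hDrow : ∀ x, ∫ u, D x u ∂μ ≤ 2 * κ₁ * a := schur_row_le μ hκ₁ hball hN hL0 ha0.le
  have hDcol : ∀ u, ∫ x, D x u ∂μ ≤ 2 * κ₁ * a := fun u => by
    have : ∀ x, D x u = D u x := fun x => by simp only [hD, dist_comm]
    simp_rw [this]
    exact hDrow u
  have hDx : ∀ x, Continuous (D x) := fun x => hDc.comp (Continuous.prodMk_right x)
  have hGx : ∀ x, Continuous (G x) := fun x => hGc.comp (Continuous.prodMk_right x)
  refine ⟨fun x => ∫ u, D x u * ‖Q u‖ ∂μ, continuous_integral_mul hDc Q.continuous.norm,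
    fun x => integral_nonneg fun u => mul_nonneg (hD0 x u) (norm_nonneg _), fun x z hxz => ?_,
    fun p hp => ?_, fun x => ?_⟩
  · have e : P x - P z = ∫ u, Q u * (conj (k x u) - conj (k z u)) ∂μ := by
      have i : ∀ w, Integrable (fun u => Q u * conj (k w u)) μ := fun w =>
        (Q.continuous.mul
          (Complex.continuous_conj.comp (k w).continuous)).integrable_of_compactSpace μ
      simp only [mul_sub]
      rw [integral_sub (i x) (i z), ← integralOp_apply, ← integralOp_apply, hQ]
    rw [e]
    refine norm_integral_le_of_norm_le
      (((hDx x).mul Q.continuous.norm).integrable_of_compactSpace μ) (.of_forall fun u => ?_)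
    rw [norm_mul, mul_comm, ← map_sub, RCLike.norm_conj, hk, hk, norm_sub_rev]
    gcongr
    refine (h.norm_heatKernel_sub_le hκ₂ hκ₃ hL N hr hLr hxz).trans ?_
    have h1 : 1 ≤ 1 + L * dist x u := by
      have : 0 ≤ L * dist x u := by positivity
      linarith
    calc _ = a * L ^ α * ((1 + L * dist x u) ^ (2 * N))⁻¹ := by rw [ha, hC]; ring
      _ ≤ _ := by
        simp only [hD]
        gcongr
        omega
  · have h1 := integral_rpow_integral_mul_le hDc hD0 Q.continuous.norm (fun _ => norm_nonneg _)
      (by positivity) hp hDrow hDcol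
    have h2 := integral_rpow_integral_mul_le hGc hG0 P.continuous.norm (fun _ => norm_nonneg _)
      (A := S + 1) (by positivity) hp (fun x => (hGrow x).trans (by linarith))
      (fun y => (hGcol y).trans (by linarith))
    have h3 : ∫ x, ‖Q x‖ ^ p ∂μ ≤ ∫ x, (∫ y, G x y * ‖P y‖ ∂μ) ^ p ∂μ := by
      have hp0 : 0 ≤ p := by linarith
      refine integral_mono
        ((Q.continuous.norm.rpow_const fun _ => Or.inr hp0).integrable_of_compactSpace μ)
        (((continuous_integral_mul hGc P.continuous.norm).rpow_const
          fun _ => Or.inr hp0).integrable_of_compactSpace μ)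
        fun x => Real.rpow_le_rpow (norm_nonneg _) (hQG x) hp0
    calc _ ≤ (2 * κ₁ * a) ^ p * ((S + 1) ^ p * ∫ x, ‖P x‖ ^ p ∂μ) := by
          refine h1.trans ?_
          gcongr
          exact h3.trans h2
      _ = _ := by
          rw [← mul_assoc, ← Real.mul_rpow (by positivity) (by positivity), ha]
          congr 2
          ring
  · have hQn : ∀ u, ‖Q u‖ ≤ (S + 1) * ‖P‖ := fun u => by
      refine (hQG u).trans ?_
      calc _ ≤ ∫ y, G u y * ‖P‖ ∂μ := by
            refine integral_mono (((hGx u).mul P.continuous.norm).integrable_of_compactSpace μ)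
              (((hGx u).integrable_of_compactSpace μ).mul_const _) fun y => ?_
            exact mul_le_mul_of_nonneg_left (P.norm_coe_le_norm y) (hG0 u y)
        _ ≤ _ := by
            rw [integral_mul_const]
            gcongr
            linarith [hGrow u]
    calc _ ≤ ∫ u, D x u * ((S + 1) * ‖P‖) ∂μ := by
          refine integral_mono (((hDx x).mul Q.continuous.norm).integrable_of_compactSpace μ)
            (((hDx x).integrable_of_compactSpace μ).mul_const _) fun u => ?_
          exact mul_le_mul_of_nonneg_left (hQn u) (hD0 x u)
      _ ≤ 2 * κ₁ * a * ((S + 1) * ‖P‖) := by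
          rw [integral_mul_const]
          gcongr
          exact hDrow x
      _ = _ := by rw [ha]; ring

end Local

/-- Since all `ℓ j ≥ 1`, degrees below 1 are trivial; for them the time `L⁻²` would leave the range
of the heat kernel bounds. -/
lemma eq_zero_of_mem_diffusionPoly {q : ℕ} {M : Type*} [MetricSpace M]
    [ChartedSpace (EuclideanSpace ℝ (Fin q)) M]
    [Bundle.RiemannianBundle (fun x : M => TangentSpace (𝓡 q) x)]
    [MeasurableSpace M] {μ : Measure M} {α κ₂ κ₃ κ₄ : ℝ} {φ : ℕ → C(M, ℂ)} {ℓ : ℕ → ℝ}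
    (h : IsDiffusionSystem (q := q) μ α κ₂ κ₃ κ₄ φ ℓ) {L : ℝ} (hL : L < 1) {P : C(M, ℂ)}
    (hP : P ∈ diffusionPoly φ ℓ L) : P = 0 := by
  have : {j | ℓ j ≤ L} = ∅ := by
    ext j
    simpa using hL.trans_le (h.one_le_ell j)
  rwa [diffusionPoly, this, Set.image_empty, Submodule.span_empty, Submodule.mem_bot] at hP

/-! ### Essential suprema of continuous functions and the support of `μ`. -/

section SupNorm

variable {X : Type*} [MetricSpace X] [CompactSpace X] [MeasurableSpace X] [BorelSpace X]

lemma memLp_top (P : C(X, ℂ)) (m : Measure X) : MemLp P ∞ m :=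
  memLp_top_of_bound P.continuous.aestronglyMeasurable ‖P‖
    (.of_forall fun x => P.norm_coe_le_norm x)

lemma lpNorm_top_le (P : C(X, ℂ)) (m : Measure X) : lpNorm P ∞ m ≤ ‖P‖ := by
  rw [← toReal_eLpNorm P.continuous.aestronglyMeasurable]
  refine ENNReal.toReal_le_of_le_ofReal (norm_nonneg _) ?_
  rw [eLpNorm_exponent_top]
  exact eLpNormEssSup_le_of_ae_bound (.of_forall fun x => P.norm_coe_le_norm x)

/-- The set where `|P|` is at most its essential supremum is closed and of full measure, hence
contains the support. -/
lemma norm_le_lpNorm_top (P : C(X, ℂ)) {m : Measure X} {x : X} (hx : x ∈ m.support) :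
    ‖P x‖ ≤ lpNorm P ∞ m := by
  have h : m.support ⊆ {y | ‖P y‖ ≤ lpNorm P ∞ m} :=
    Measure.support_subset_of_isClosed (isClosed_le P.continuous.norm continuous_const)
      (ae_le_lpNorm_exponent_top (memLp_top P m))
  exact h hx

end SupNorm

section Support

variable {q : ℕ} {M : Type*} [MetricSpace M] [CompactSpace M]
    [ChartedSpace (EuclideanSpace ℝ (Fin q)) M]
    [Bundle.RiemannianBundle (fun x : M => TangentSpace (𝓡 q) x)]
    [MeasurableSpace M] [BorelSpace M] {μ : Measure M} [IsProbabilityMeasure μ]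
    {α κ₂ κ₃ κ₄ : ℝ} {φ : ℕ → C(M, ℂ)} {ℓ : ℕ → ℝ}

/-- The measure has full support, as `∫ K_t(x, y) dμ(y) = exp (-t)` does not vanish for `t → 0`. -/
lemma IsDiffusionSystem.mem_support (h : IsDiffusionSystem (q := q) μ α κ₂ κ₃ κ₄ φ ℓ)
    (hκ₂ : 0 < κ₂) (hκ₃ : 0 < κ₃) (hκ₄ : 0 < κ₄) (x : M) : x ∈ μ.support := by
  rw [Metric.nhds_basis_ball.mem_measureSupport]
  intro r hr
  by_contra hzero
  have hzero : μ (Metric.ball x r) = 0 := by simpa using hzero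
  set N := ⌈α⌉₊ + 1
  set C := κ₂ * ((2 / κ₃) ^ N * N.factorial * Real.exp κ₃) with hC
  have hC0 : 0 < C := by positivity
  have key : ∀ L : ℝ, 1 ≤ L → Real.exp (-1) ≤ C * (r ^ (2 * N))⁻¹ * L⁻¹ := by
    intro L hL
    have hL0 : 0 < L := by linarith
    have ht1 : (L ^ 2)⁻¹ ≤ 1 := inv_le_one_of_one_le₀ (one_le_pow₀ hL)
    have h1 := h.integral_mul_heatKernel hκ₄ (t := (L ^ 2)⁻¹) (by positivity) ht1 x 0
    simp only [h.phi_zero, one_mul, mul_one, h.ell_zero] at h1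
    have h2 : ‖∫ y, heatKernel φ ℓ (L ^ 2)⁻¹ x y ∂μ‖ ≤ C * (r ^ (2 * N))⁻¹ * L⁻¹ := by
      have hae : ∀ᵐ y ∂μ, ‖heatKernel φ ℓ (L ^ 2)⁻¹ x y‖ ≤ C * (r ^ (2 * N))⁻¹ * L⁻¹ := by
        have : ∀ᵐ y ∂μ, y ∉ Metric.ball x r := measure_eq_zero_iff_ae_notMem.1 hzero
        filter_upwards [this] with y hy
        rw [Metric.mem_ball, not_lt, dist_comm] at hy
        refine (h.norm_heatKernel_le hκ₂ hκ₃ hL N x y).trans ?_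
        rw [← hC]
        have h3 : L ^ α * ((1 + L * dist x y) ^ (2 * N))⁻¹ ≤ (r ^ (2 * N))⁻¹ * L⁻¹ := by
          calc _ ≤ L ^ ((2 * N : ℕ) - 1 : ℝ) * ((L * r) ^ (2 * N))⁻¹ := by
                have hLr : L * r ≤ 1 + L * dist x y := by nlinarith
                have hα : α ≤ (2 * N : ℕ) - 1 := by
                  have := Nat.le_ceil α
                  have h0 : (0 : ℝ) ≤ ⌈α⌉₊ := Nat.cast_nonneg _
                  simp only [N]
                  push_cast
                  linarith
                gcongr
            _ = _ := by
                rw [Real.rpow_sub_one hL0.ne', Real.rpow_natCast, mul_pow]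
                field_simp
        calc _ = C * (L ^ α * ((1 + L * dist x y) ^ (2 * N))⁻¹) := by ring
          _ ≤ C * ((r ^ (2 * N))⁻¹ * L⁻¹) := by gcongr
          _ = _ := by ring
      simpa using norm_integral_le_of_norm_le_const hae
    rw [h1, Complex.norm_real, Real.norm_of_nonneg (Real.exp_pos _).le] at h2
    refine le_trans (Real.exp_le_exp.2 ?_) h2
    linarith
  have hpos : 0 < Real.exp (-1) := Real.exp_pos _
  set D := C * (r ^ (2 * N))⁻¹ with hD
  have hD0 : 0 < D := by positivity
  -- At this `L` the bound `L exp (-1) ≤ D` reads `exp (-1) + D ≤ D`, a contradiction.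
  have h4 := key (1 + D / Real.exp (-1)) (by
    have : 0 ≤ D / Real.exp (-1) := by positivity
    linarith)
  rw [← div_eq_mul_inv, le_div_iff₀ (by positivity)] at h4
  have h5 : Real.exp (-1) * (1 + D / Real.exp (-1)) = Real.exp (-1) + D := by field_simp
  linarith

end Support

/-! ### From oscillation of `P` to sums over a partition. -/

lemma abs_rpow_sub_rpow_le {a b f p : ℝ} (ha : 0 ≤ a) (hb : 0 ≤ b) (hp : 1 ≤ p)
    (hf : |a - b| ≤ f) : |a ^ p - b ^ p| ≤ p * (a + f) ^ (p - 1) * f := by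
  have key : ∀ s g : ℝ, 0 ≤ s → 0 ≤ g → s ≤ a + f → s - g ≤ f →
      s ^ p - g ^ p ≤ p * (a + f) ^ (p - 1) * f := by
    intro s g hs hg hsa hsg
    have hf0 : 0 ≤ f := (abs_nonneg _).trans hf
    have h1 := mul_rpow_sub_one_mul_le hp hs hg
    have h2 : s ^ (p - 1) * s = s ^ p := by
      rcases hs.eq_or_lt with h | h
      · rw [← h, Real.zero_rpow (by linarith : p ≠ 0), mul_zero]
      · rw [← Real.rpow_add_one h.ne', sub_add_cancel]
    calc s ^ p - g ^ p ≤ p * (s ^ (p - 1) * s) - p * s ^ (p - 1) * g := by rw [h2]; linarith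
      _ = p * s ^ (p - 1) * (s - g) := by ring
      _ ≤ p * s ^ (p - 1) * f := by gcongr
      _ ≤ _ := by gcongr
  have h := abs_le.1 hf
  have hf0 : 0 ≤ f := (abs_nonneg _).trans hf
  rw [abs_sub_le_iff]
  exact ⟨key a b ha hb (by linarith) (by linarith), key b a hb ha (by linarith) (by linarith)⟩

/-- Convexity is used with weights `1 / (1 + ε)` and `ε / (1 + ε)`, so the constant is a power of `1
+ ε`, bounded when `ε p ≤ 1`. Equal weights would cost `2^(p-1)` and spoil the dependence on `p`. -/
lemma mul_add_rpow_sub_one_mul_le {a g ε p : ℝ} (ha : 0 ≤ a) (hg : 0 ≤ g) (hε : 0 < ε)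
    (hp : 1 ≤ p) : p * (a + ε * g) ^ (p - 1) * (ε * g) ≤
      ε * ((p - 1) * ((1 + ε) ^ (p - 1) * (a ^ p + ε * g ^ p)) + g ^ p) := by
  have h1 := mul_rpow_sub_one_mul_le hp (by positivity : 0 ≤ a + ε * g) hg
  have h2 : (a + ε * g) ^ p ≤ (1 + ε) ^ (p - 1) * (a ^ p + ε * g ^ p) := by
    have hc := (convexOn_rpow hp).2 (Set.mem_Ici.2 ha) (Set.mem_Ici.2 hg)
      (by positivity : 0 ≤ 1 / (1 + ε)) (by positivity : 0 ≤ ε / (1 + ε)) (by field_simp)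
    simp only [smul_eq_mul] at hc
    have e1 : 1 / (1 + ε) * a + ε / (1 + ε) * g = (a + ε * g) / (1 + ε) := by field_simp
    have e2 : 1 / (1 + ε) * a ^ p + ε / (1 + ε) * g ^ p = (a ^ p + ε * g ^ p) / (1 + ε) := by
      field_simp
    rw [e1, e2, Real.div_rpow (by positivity) (by positivity), div_le_iff₀ (by positivity)] at hc
    refine hc.trans_eq ?_
    rw [Real.rpow_sub_one (by positivity)]
    field_simp
  have h3 := mul_le_mul_of_nonneg_left h2 (by linarith : 0 ≤ p - 1)
  calc _ = ε * (p * (a + ε * g) ^ (p - 1) * g) := by ring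
    _ ≤ ε * ((p - 1) * (a + ε * g) ^ p + g ^ p) := by gcongr
    _ ≤ _ := by gcongr

section Partition

variable {X : Type*} [MetricSpace X] [CompactSpace X] [MeasurableSpace X] [BorelSpace X]
  {μ : Measure X} [IsProbabilityMeasure μ] {m : Measure X} [IsFiniteMeasure m]

/-- Compare `u y` with the `m`-average of `u` over `Y`, then integrate in `y`. As `H` depends on `y`
alone, `m` drops out of the bound. -/
lemma abs_setIntegral_sub_average_le {Y : Set X} (hY : MeasurableSet Y) (hm : 0 < m.real Y)
    {u H : X → ℝ} (hu : Continuous u) (hH : Continuous H)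
    (h : ∀ y ∈ Y, ∀ z ∈ Y, |u y - u z| ≤ H y) :
    |(∫ y in Y, u y ∂μ) - μ.real Y / m.real Y * ∫ z in Y, u z ∂m| ≤ ∫ y in Y, H y ∂μ := by
  set v := (∫ z in Y, u z ∂m) / m.real Y with hv
  have h1 : ∀ y ∈ Y, |u y - v| ≤ H y := by
    intro y hy
    have e : u y - v = (∫ z in Y, (u y - u z) ∂m) / m.real Y := by
      rw [integral_sub (integrable_const _) (hu.integrable_of_compactSpace _), setIntegral_const,
        smul_eq_mul, hv]
      field_simp
    have h2 : ‖∫ z in Y, (u y - u z) ∂m‖ ≤ H y * m.real Y :=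
      norm_setIntegral_le_of_norm_le_const (measure_lt_top _ _) fun z hz => h y hy z hz
    rw [e, abs_div, abs_of_pos hm, div_le_iff₀ hm]
    exact h2
  have e : (∫ y in Y, u y ∂μ) - μ.real Y / m.real Y * ∫ z in Y, u z ∂m =
      ∫ y in Y, (u y - v) ∂μ := by
    rw [integral_sub (hu.integrable_of_compactSpace _) (integrable_const _), setIntegral_const,
      smul_eq_mul, hv]
    ring
  rw [e, ← Real.norm_eq_abs]
  exact norm_integral_le_of_norm_le (hH.integrable_of_compactSpace _)
    ((ae_restrict_iff' hY).2 (.of_forall h1))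

lemma sum_abs_setIntegral_sub_average_le {C : Finset X} {Y : X → Set X}
    (hY : ∀ x ∈ C, MeasurableSet (Y x)) (hdisj : (C : Set X).PairwiseDisjoint Y)
    (hcover : ⋃ x ∈ C, Y x = Set.univ) (hm : ∀ x ∈ C, 0 < m.real (Y x))
    {P : C(X, ℂ)} {f : X → ℝ} (hf : Continuous f) (hf0 : ∀ y, 0 ≤ f y)
    (hosc : ∀ x ∈ C, ∀ y ∈ Y x, ∀ z ∈ Y x, ‖P y - P z‖ ≤ f y) {ε p η : ℝ} (hε : 0 < ε)
    (hp : 1 ≤ p) (hη : 3 * (ε * p) ≤ η) (hη1 : ε * p ≤ 1)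
    (hfP : ∫ y, f y ^ p ∂μ ≤ ε ^ p * ∫ y, ‖P y‖ ^ p ∂μ) :
    ∑ x ∈ C, |(∫ y in Y x, ‖P y‖ ^ p ∂μ) - μ.real (Y x) / m.real (Y x) *
      ∫ z in Y x, ‖P z‖ ^ p ∂m| ≤ η * ∫ y, ‖P y‖ ^ p ∂μ := by
  have hp0 : 0 ≤ p := by linarith
  set g : X → ℝ := fun y => f y / ε with hg
  have hg0 : ∀ y, 0 ≤ g y := fun y => div_nonneg (hf0 y) hε.le
  have hfg : ∀ y, f y = ε * g y := fun y => by simp only [hg]; field_simp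
  have hPc : Continuous fun y => ‖P y‖ ^ p := P.continuous.norm.rpow_const fun _ => Or.inr hp0
  have hgc : Continuous fun y => g y ^ p := (hf.div_const ε).rpow_const fun _ => Or.inr hp0
  have hPi := hPc.integrable_of_compactSpace μ
  have hgi := hgc.integrable_of_compactSpace μ
  set I := ∫ y, ‖P y‖ ^ p ∂μ with hI
  have hI0 : 0 ≤ I := integral_nonneg fun y => by positivity
  have hgI : ∫ y, g y ^ p ∂μ ≤ I := by
    have e : ∫ y, f y ^ p ∂μ = ε ^ p * ∫ y, g y ^ p ∂μ := by
      rw [← integral_const_mul]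
      congr with y
      rw [hfg, Real.mul_rpow hε.le (hg0 y)]
    rw [e] at hfP
    exact le_of_mul_le_mul_left hfP (by positivity)
  set H : X → ℝ := fun y =>
    ε * ((p - 1) * ((1 + ε) ^ (p - 1) * (‖P y‖ ^ p + ε * g y ^ p)) + g y ^ p) with hH
  have hHc : Continuous H := continuous_const.mul ((continuous_const.mul (continuous_const.mul
    (hPc.add (continuous_const.mul hgc)))).add hgc)
  have hHi := hHc.integrable_of_compactSpace μ
  have h1 : ∀ x ∈ C, |(∫ y in Y x, ‖P y‖ ^ p ∂μ) - μ.real (Y x) / m.real (Y x) *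
      ∫ z in Y x, ‖P z‖ ^ p ∂m| ≤ ∫ y in Y x, H y ∂μ := fun x hx => by
    refine abs_setIntegral_sub_average_le (hY x hx) (hm x hx) hPc hHc fun y hy z hz => ?_
    have h2 : |‖P y‖ - ‖P z‖| ≤ ε * g y := by
      rw [← hfg]
      exact (abs_norm_sub_norm_le _ _).trans (hosc x hx y hy z hz)
    exact (abs_rpow_sub_rpow_le (norm_nonneg _) (norm_nonneg _) hp h2).trans
      (mul_add_rpow_sub_one_mul_le (norm_nonneg _) (hg0 y) hε hp)
  have h2 : ∑ x ∈ C, ∫ y in Y x, H y ∂μ = ∫ y, H y ∂μ := by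
    rw [← integral_biUnion_finset C hY hdisj fun x _ => hHi.integrableOn, hcover,
      Measure.restrict_univ]
  have h3 : ∫ y, H y ∂μ =
      ε * ((p - 1) * ((1 + ε) ^ (p - 1) * (I + ε * ∫ y, g y ^ p ∂μ)) + ∫ y, g y ^ p ∂μ) := by
    simp only [hH]
    rw [integral_const_mul, integral_add _ hgi, integral_const_mul, integral_const_mul,
      integral_add hPi (hgi.const_mul _), integral_const_mul]
    exact ((hPi.add (hgi.const_mul _)).const_mul _).const_mul _
  -- With this the total error factor `ε ((p - 1) (1 + ε)^p + 1)` is at most `3 ε p`, linear in `p`.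
  have h4 : (1 + ε) ^ p ≤ 3 := by
    calc (1 + ε) ^ p ≤ Real.exp ε ^ p := by
          gcongr; linarith [Real.add_one_le_exp ε]
      _ = Real.exp (ε * p) := by rw [← Real.exp_mul]
      _ ≤ Real.exp 1 := Real.exp_le_exp.2 hη1
      _ ≤ 3 := Real.exp_one_lt_three.le
  calc _ ≤ ∑ x ∈ C, ∫ y in Y x, H y ∂μ := Finset.sum_le_sum h1
    _ ≤ ε * ((p - 1) * ((1 + ε) ^ (p - 1) * (I + ε * I)) + I) := by
        rw [h2, h3]
        have : 0 ≤ p - 1 := by linarith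
        gcongr
    _ = ε * ((p - 1) * (1 + ε) ^ p + 1) * I := by
        rw [Real.rpow_sub_one (by positivity)]; field_simp
    _ ≤ ε * ((p - 1) * 3 + 3) * I := by
        have : 0 ≤ p - 1 := by linarith
        gcongr
        norm_num
    _ = 3 * (ε * p) * I := by ring
    _ ≤ η * I := by gcongr

end Partition

/-! ### The main theorem. -/

theorem mainTheorem3 {q : ℕ} {M : Type*} [MetricSpace M] [CompactSpace M] [ConnectedSpace M]
    [ChartedSpace (EuclideanSpace ℝ (Fin q)) M] [IsManifold (𝓡 q) ∞ M]
    [Bundle.RiemannianBundle (fun x : M => TangentSpace (𝓡 q) x)]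
    [IsContMDiffRiemannianBundle (𝓡 q) ∞ (EuclideanSpace ℝ (Fin q))
      (fun x : M => TangentSpace (𝓡 q) x)]
    [IsRiemannianManifold (𝓡 q) M]
    [MeasurableSpace M] [BorelSpace M] (μ : Measure M) [IsProbabilityMeasure μ]
    (α κ₁ κ₂ κ₃ κ₄ : ℝ) (hα : 0 < α) (hκ₁ : 0 < κ₁) (hκ₂ : 0 < κ₂) (hκ₃ : 0 < κ₃)
    (hκ₄ : 0 < κ₄)
    (hball : ∀ (x : M) (r : ℝ), 0 < r → μ.real (Metric.closedBall x r) ≤ κ₁ * r ^ α) :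
    ∃ c₁ c₂ c₃ : ℝ, 0 < c₁ ∧ 0 < c₂ ∧ 0 < c₃ ∧
      ∀ (φ : ℕ → C(M, ℂ)) (ℓ : ℕ → ℝ), IsDiffusionSystem (q := q) μ α κ₂ κ₃ κ₄ φ ℓ →
      ∀ (ν : SignedMeasure M) (d : ℝ),
        meshNorm ν.totalVariation.support < ENNReal.ofReal d → d ≤ 1 / 81 →
        (∀ (b₁ b₂ b₃ : ℝ), 0 < b₁ → 0 < b₂ → 0 < b₃ →
          ∀ (C : Finset M) (Y : M → Set M), IsAdaptedPartition μ ν α d b₁ b₂ b₃ C Y →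
          ∀ p η : ℝ, 1 ≤ p → 0 < η → η ≤ 1 → d ≤ c₁ →
          ∀ L : ℝ, L ≤ c₂ * η / (p * d) → ∀ P ∈ diffusionPoly φ ℓ L,
            ∑ x ∈ C, |(∫ y in Y x, ‖P y‖ ^ p ∂μ) -
                μ.real (Y x) / ν.totalVariation.real (Y x) *
                  ∫ z in Y x, ‖P z‖ ^ p ∂ν.totalVariation|
              ≤ η * lpNorm P (ENNReal.ofReal p) μ ^ p) ∧
        (∀ η : ℝ, 0 < η → ∀ L : ℝ, L ≤ c₃ * η / d → ∀ P ∈ diffusionPoly φ ℓ L,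
            |lpNorm P ∞ ν.totalVariation - lpNorm P ∞ μ| ≤ η * lpNorm P ∞ μ) := by
  obtain ⟨A, hA, key⟩ := exists_oscillation_bound (q := q) hκ₁ hκ₂ hκ₃ hκ₄ hball
  -- Two points of a cell are within `2 · 81 d = 162 d`: the first entry of the minimum gives `L ·
  -- 162 d ≤ 1`, the second, with `486 = 3 · 162`, pays for the factor 3 in the partition estimate.
  -- The last constant gives both `L d ≤ 1`, for `η < 1`, and `A L d ≤ η`.
  refine ⟨1, min (1 / 162) (1 / (486 * A)), 1 / (A + 1), one_pos, by positivity, by positivity,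
    fun φ ℓ h ν d hd _ => ⟨?_, ?_⟩⟩
  all_goals
    have hd0 : 0 < d := ENNReal.ofReal_pos.1 (hd.trans_le' zero_le)
  · intro b₁ b₂ b₃ _ _ hb₃ C Y hY p η hp hη hη1 _ L hL P hP
    have hp0 : 0 < p := by linarith
    have hint : lpNorm P (ENNReal.ofReal p) μ ^ p = ∫ y, ‖P y‖ ^ p ∂μ := by
      rw [lpNorm_eq_integral_norm_rpow_toReal (by simpa using hp0) ENNReal.ofReal_ne_top
        P.continuous.aestronglyMeasurable, ENNReal.toReal_ofReal hp0.le,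
        Real.rpow_inv_rpow (integral_nonneg fun y => by positivity) hp0.ne']
    rcases lt_or_ge L 1 with hL1 | hL1
    · rw [eq_zero_of_mem_diffusionPoly h hL1 hP]
      simp [Real.zero_rpow hp0.ne']
    have hLd : p * (L * d) ≤ min (1 / 162) (1 / (486 * A)) * η := by
      rw [le_div_iff₀ (by positivity)] at hL
      linarith
    have hLd1 : p * (L * d) ≤ 1 / 162 * η :=
      hLd.trans (mul_le_mul_of_nonneg_right (min_le_left _ _) hη.le)
    have hLd2 : p * (L * d) ≤ 1 / (486 * A) * η :=
      hLd.trans (mul_le_mul_of_nonneg_right (min_le_right _ _) hη.le)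
    have hε : 3 * (A * (L * (162 * d)) * p) ≤ η := by
      calc _ = 486 * A * (p * (L * d)) := by ring
        _ ≤ 486 * A * (1 / (486 * A) * η) := by gcongr
        _ = η := by field_simp
    have hLd3 : L * d ≤ p * (L * d) := le_mul_of_one_le_left (by positivity) hp
    obtain ⟨f, hfc, hf0, hosc, hfp, -⟩ := key φ ℓ h L (162 * d) hL1 (by positivity)
      (by linarith) P hP
    rw [hint]
    refine sum_abs_setIntegral_sub_average_le hY.measurable hY.disjoint hY.cover
      (fun x hx => ?_) hfc hf0 (fun x hx y hy z hz => hosc y z ?_)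
      (ε := A * (L * (162 * d))) (by positivity) hp hε (by linarith) (hfp p hp)
    · obtain ⟨D, -, hD, hDx⟩ := hY.nu_lower
      obtain ⟨z, hz, hzx⟩ := hDx x hx
      refine lt_of_lt_of_le (mul_pos hb₃ ?_) hzx
      exact ENNReal.toReal_pos (hD z hz).ne' (measure_ne_top _ _)
    · have h1 := Metric.mem_closedBall.1 (hY.subset_ball x hx hy)
      have h2 := Metric.mem_closedBall'.1 (hY.subset_ball x hx hz)
      linarith [dist_triangle y x z]
  · intro η hη L hL P hP
    have hμ : lpNorm P ∞ μ = ‖P‖ := by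
      refine le_antisymm (lpNorm_top_le P μ) ((P.norm_le lpNorm_nonneg).2 fun x => ?_)
      exact norm_le_lpNorm_top P (h.mem_support hκ₂ hκ₃ hκ₄ x)
    have hν := lpNorm_top_le P ν.totalVariation
    have hν0 : 0 ≤ lpNorm P ∞ ν.totalVariation := lpNorm_nonneg
    rw [hμ, abs_sub_comm, abs_of_nonneg (by linarith)]
    -- For `η ≥ 1` the claim is trivial, as the `ν`-norm lies between 0 and `‖P‖`.
    rcases le_or_gt 1 η with hη1 | hη1
    · nlinarith [norm_nonneg P]
    rcases lt_or_ge L 1 with hL1 | hL1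
    · rw [eq_zero_of_mem_diffusionPoly h hL1 hP]
      simp
    have hLd : L * d ≤ 1 / (A + 1) * η := by rwa [le_div_iff₀ hd0] at hL
    have hLd' : (A + 1) * (L * d) ≤ η := by
      calc _ ≤ (A + 1) * (1 / (A + 1) * η) := by gcongr
        _ = η := by field_simp
    have hLd0 : 0 < L * d := by positivity
    have hALd : 0 < A * (L * d) := by positivity
    obtain ⟨f, -, -, hosc, -, hfs⟩ := key φ ℓ h L d hL1 hd0 (by linarith) P hP
    have hbound : ∀ x, ‖P x‖ ≤ lpNorm P ∞ ν.totalVariation + η * ‖P‖ := fun x => by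
      have h1 : Metric.infEDist x ν.totalVariation.support < ENNReal.ofReal d :=
        (le_iSup (fun x => Metric.infEDist x ν.totalVariation.support) x).trans_lt hd
      obtain ⟨y, hy, hxy⟩ := Metric.infEDist_lt_iff.1 h1
      rw [edist_dist, ENNReal.ofReal_lt_ofReal_iff hd0] at hxy
      have h2 := norm_le_lpNorm_top P hy
      have h3 := (hosc x y hxy.le).trans (hfs x)
      have h4 : A * (L * d) * ‖P‖ ≤ η * ‖P‖ := by
        gcongr
        linarith
      linarith [norm_le_insert' (P x) (P y)]
    have := (P.norm_le (by positivity)).2 hbound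
    linarith
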